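/- **Setting.** Let $\mathbb L^{n}_+=\{x\in\mathbb R^n : x_1\ge\|x_{2:n}\|\}$ be the second-order cone ($n\ge 1$, Euclidean norm), $\mathcal L=\mathbb L^{n_1}_+\times\dots\times\mathbb L^{n_p}_+$, $A=(A^1,\dots,A^p)$ with $A^i\in\mathbb R^{m\times n_i}$, $b\in\mathbb R^m$, and let $c,\bar c$ be block vectors. For $\epsilon\in\mathbb R$ consider $$(\mathrm P_\epsilon)\ \inf\{(c+\epsilon\bar c)^Tx : Ax=b,\ x\in\mathcal L\},\qquad (\mathrm D_\epsilon)\ \sup\{b^Ty : A^Ty+s=c+\epsilon\bar c,\ s\in\mathcal L\}.$$ Let $\psi(\epsilon)$ be the optimal value of $(\mathrm P_\epsilon)$, $\mathcal E=\{\epsilon:\psi(\epsilon)>-\infty\}$, $\mathcal P^*(\epsilon)$ the set of primal feasible $x$ with objective value $\psi(\epsilon)$, and $\mathcal D^*(\epsilon)$ the set of dual feasible $(y;s)$ with $b^Ty=\psi(\epsilon)$. Assume the interior point condition at $\epsilon=0$: there are feasible $x$ and $(y;s)$ for $(\mathrm P_0)$, $(\mathrm D_0)$ with $x^i,s^i\in\operatorname{int}\mathbb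 L^{n_i}_+$ for all $i$. The optimal partition $\pi(\epsilon)=(\mathcal B,\mathcal N,\mathcal R,(\mathcal T_1,\mathcal T_2,\mathcal T_3))$ consists of the sets of indices $i$ such that, respectively: $x^i_1>\|x^i_{2:n_i}\|$ for some $x\in\mathcal P^*(\epsilon)$; $s^i_1>\|s^i_{2:n_i}\|$ for some $(y;s)\in\mathcal D^*(\epsilon)$; $x^i_1=\|x^i_{2:n_i}\|>0$ and $s^i_1=\|s^i_{2:n_i}\|>0$ for some optimal $(x;y;s)$; $x^i=s^i=0$ for all optimal $(x;y;s)$; $s^i=0$ for all $(y;s)\in\mathcal D^*(\epsilon)$ and $x^i_1=\|x^i_{2:n_i}\|>0$ for some $x\in\mathcal P^*(\epsilon)$; $x^i=0$ for all $x\in\mathcal P^*(\epsilon)$ and $s^i_1=\|s^i_{2:n_i}\|>0$ for some $(y;s)\in\mathcal D^*(\epsilon)$. A solution $(x;y;s)$ is maximally complementary if $x\in\operatorname{ri}\mathcal P^*(\epsilon)$ and $(y;s)\in\operatorname{ri}\mathcal D^*(\epsilon)$. Let $R^i=\operatorname{diag}(1,-1,\dots,-1)\in\mathbb R^{n_i\times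 n_i}$ and let $L(x^i)=\begin{pmatrix}x^i_1&(x^i_{2:n_i})^T\\x^i_{2:n_i}&x^i_1I\end{pmatrix}$. Primal and dual nondegeneracy hold at $\epsilon$ if there is a maximally complementary solution $(x;y;s)$ at $\epsilon$ such that $\big((A^iP^i)_{\mathcal R\cup\mathcal T_2},(A^i)_{\mathcal B}\big)$ has full row rank, where the $n_i-1$ columns of $P^i$ are orthonormal eigenvectors for the positive eigenvalues of $L(x^i)$, and $\big((A^iR^is^i)_{\mathcal R\cup\mathcal T_3},(A^i)_{\mathcal B\cup\mathcal T_1\cup\mathcal T_2}\big)$ has full column rank. An *invariancy interval* is a nonempty open interval $J\subseteq\operatorname{int}\mathcal E$ on which $\pi$ is constant and the extreme rays of maximally complementary solutions, $\mathbb R_+x^i$ for $i\in\mathcal R\cup\mathcal T_2$ and $\mathbb R_+s^i$ for $i\in\mathcal R\cup\mathcal T_3$, do not vary. A *nonlinearity interval* is a nonempty open interval $J\subseteq\operatorname{int}\mathcal E$, maximal among the open subintervals of $\operatorname{int}\mathcal E$ on which $\pi$ is constant, such that some of these extreme rays does vary on $J$. Fix $\bar\epsilon\in\mathbb R$ and write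 $\bar{\mathcal B},\bar{\mathcal N},\bar{\mathcal R},\bar{\mathcal T}_1,\bar{\mathcal T}_2,\bar{\mathcal T}_3$ for the index sets of $\pi(\bar\epsilon)$. The nonlinear reformulation $(\mathrm{DN}_\epsilon)$ of the dual problem is to minimize $-b^Tw$ over $w\in\mathbb R^m$ and $z=(z^i)_{i\in\bar{\mathcal R}\cup\bar{\mathcal N}\cup\bar{\mathcal T}_3}$ subject to $(A^i)^Tw=c^i+\epsilon\bar c^i$ for $i\in\bar{\mathcal B}\cup\bar{\mathcal T}_1\cup\bar{\mathcal T}_2$; $(A^i)^Tw+z^i=c^i+\epsilon\bar c^i$ for $i\in\bar{\mathcal R}\cup\bar{\mathcal N}\cup\bar{\mathcal T}_3$; $(z^i)^TR^iz^i=0$ and $z^i_1>0$ for $i\in\bar{\mathcal R}\cup\bar{\mathcal T}_3$; $z^i\in\operatorname{int}\mathbb L^{n_i}_+$ for $i\in\bar{\mathcal N}$. With multipliers $u=(u^i)_{i=1}^p$ and $v=(v_i)_{i\in\bar{\mathcal R}\cup\bar{\mathcal T}_3}$ its first-order system $G((w;z;u;v),\epsilon)=0$ consists of $-\sum_iA^iu^i-b=0$;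 $-u^i-2v_iR^iz^i=0$ for $i\in\bar{\mathcal R}\cup\bar{\mathcal T}_3$; $-u^i=0$ for $i\in\bar{\mathcal N}$; and the three families of equality constraints above. A *solution map* on $(\bar\epsilon-\rho,\bar\epsilon+\rho)$, $\rho>0$, is a real analytic $\chi(\epsilon)=(w(\epsilon);z(\epsilon);u(\epsilon);v(\epsilon))$ with $G(\chi(\epsilon),\epsilon)=0$ on this interval such that $(w(\bar\epsilon);z(\bar\epsilon))$ is a globally optimal solution of $(\mathrm{DN}_{\bar\epsilon})$ (so that $u(\bar\epsilon),v(\bar\epsilon)$ are its Lagrange multipliers). **Theorem.** Suppose that primal and dual nondegeneracy hold at $\bar\epsilon$. Then $\mathcal P^*(\bar\epsilon)$ and $\mathcal D^*(\bar\epsilon)$ are singletons, a solution map $\chi$ exists for some $\rho>0$, and for each $\rho>0$ any two solution maps coincide on $(\bar\epsilon-\rho,\bar\epsilon+\rho)$. For every solution map $\chi$, consider the condition $$(\ast)\qquad \begin{aligned}(u^i_j)^{(k)}(\bar\epsilon)&=0 && \text{for all } i\in\bar{\mathcal T}_1,\ 1\le j\le n_i,\ k\ge1,\\ \big((u^i_1)^2-\|u^i_{2:n_i}\|^2\big)^{(k)}(\bar\epsilon)&=0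 && \text{for all } i\in\bar{\mathcal T}_2,\ k\ge1,\\ v_i^{(k)}(\bar\epsilon)&=0 && \text{for all } i\in\bar{\mathcal T}_3,\ k\ge1.\end{aligned}$$ 1. The optimal partition is constant on a neighborhood of $\bar\epsilon$ contained in $\operatorname{int}\mathcal E$ if and only if $(\ast)$ holds. 2. If $\bar\epsilon$ does not lie in an invariancy interval, then $\bar\epsilon$ belongs to a nonlinearity interval if and only if $(\ast)$ holds. -/

import Mathlib

open Set Filter Topology
open scoped Matrix

noncomputable section

/-- A block vector `(x^1; …; x^p)`; the `i`-th block has `n_i = d i + 1` coordinates, so that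
`x i 0` is `x^i_1` and `fun j => x i j.succ` is `x^i_{2:n_i}`. -/
abbrev BlockVec {p : ℕ} (d : Fin p → ℕ) : Type := ∀ i : Fin p, Fin (d i + 1) → ℝ

/-- The Euclidean norm of the tail `x_{2:n}`. -/
def tailNorm {k : ℕ} (x : Fin (k + 1) → ℝ) : ℝ := Real.sqrt (∑ j : Fin k, x j.succ ^ 2)

/-- The second-order cone. -/
def soc (k : ℕ) : Set (Fin (k + 1) → ℝ) := {x | tailNorm x ≤ x 0}

/-- The interior of the second-order cone. -/
def socInt (k : ℕ) : Set (Fin (k + 1) → ℝ) := {x | tailNorm x < x 0}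

/-- The diagonal matrix `R = diag(1, -1, …, -1)`. -/
def reflMat (k : ℕ) : Matrix (Fin (k + 1)) (Fin (k + 1)) ℝ :=
  Matrix.diagonal (Fin.cons 1 fun _ => -1)

/-- The arrow-shaped matrix `L(x)`: first row and first column equal to `x`, and `x_1` on the
diagonal. -/
def arrowMat {k : ℕ} (x : Fin (k + 1) → ℝ) : Matrix (Fin (k + 1)) (Fin (k + 1)) ℝ :=
  Matrix.of fun a b => if a = 0 then x b else if b = 0 then x a else if a = b then x 0 else 0

/-- The ray `ℝ₊ x`. -/
def nonnegRay {k : ℕ} (x : Fin (k + 1) → ℝ) : Set (Fin (k + 1) → ℝ) :=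
  {y | ∃ t : ℝ, 0 ≤ t ∧ y = t • x}

/-- The index sets `(B, N, R, (T₁, T₂, T₃))` of an optimal partition of `p` cones. -/
@[ext]
structure ConePartition (p : ℕ) where
  B : Finset (Fin p)
  N : Finset (Fin p)
  R : Finset (Fin p)
  T1 : Finset (Fin p)
  T2 : Finset (Fin p)
  T3 : Finset (Fin p)

namespace ConePartition

variable {p : ℕ}

/-- The indices `R ∪ N ∪ T₃` of the slack variables `z^i`. -/
abbrev slackIdx (P : ConePartition p) : Finset (Fin p) := P.R ∪ P.N ∪ P.T3

/-- The indices `R ∪ T₃` of the quadratic constraints and their multipliers `v_i`. -/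
abbrev quadIdx (P : ConePartition p) : Finset (Fin p) := P.R ∪ P.T3

theorem mem_slackIdx_of_mem_quadIdx {P : ConePartition p} {i : Fin p} (h : i ∈ P.quadIdx) :
    i ∈ P.slackIdx := by
  simp only [quadIdx, slackIdx, Finset.mem_union] at h ⊢
  tauto

theorem mem_quadIdx_of_mem_T3 {P : ConePartition p} {i : Fin p} (h : i ∈ P.T3) :
    i ∈ P.quadIdx := Finset.mem_union_right _ h

end ConePartition

/-- The slack variables `z = (z^i)`, `i ∈ R ∪ N ∪ T₃`. -/
abbrev SlackVec {p : ℕ} (d : Fin p → ℕ) (P : ConePartition p) : Type :=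
  ∀ i : {i // i ∈ P.slackIdx}, Fin (d i + 1) → ℝ

/-- The space of the quadruples `(w; z; u; v)` with `w ∈ ℝ^m`, `z^i` for `i ∈ R ∪ N ∪ T₃`, `u^i`
for every cone `i`, and `v_i` for `i ∈ R ∪ T₃`. -/
abbrev KKTVar (m : ℕ) {p : ℕ} (d : Fin p → ℕ) (P : ConePartition p) : Type :=
  (Fin m → ℝ) × SlackVec d P × BlockVec d × ({i // i ∈ P.quadIdx} → ℝ)

namespace KKTVar

variable {m p : ℕ} {d : Fin p → ℕ} {P : ConePartition p}

abbrev w (q : KKTVar m d P) : Fin m → ℝ := q.1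

abbrev z (q : KKTVar m d P) : SlackVec d P := q.2.1

abbrev u (q : KKTVar m d P) : BlockVec d := q.2.2.1

abbrev v (q : KKTVar m d P) : {i // i ∈ P.quadIdx} → ℝ := q.2.2.2

end KKTVar

/-- The data of a pair of parametric second-order conic problems
`min {(c + ε c̄)ᵀ x : A x = b, x ∈ K}` and `max {bᵀ y : Aᵀ y + s = c + ε c̄, s ∈ K}`, where `K` is
the product of `p` second-order cones of dimensions `d i + 1` and `A = (A^1, …, A^p)`. -/
structure ParamSOCO (m p : ℕ) (d : Fin p → ℕ) where
  A : ∀ i : Fin p, Matrix (Fin m) (Fin (d i + 1)) ℝ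
  b : Fin m → ℝ
  c : BlockVec d
  cbar : BlockVec d

namespace ParamSOCO

variable {m p : ℕ} {d : Fin p → ℕ} (S : ParamSOCO m p d)

/-- The perturbed objective vector, block `i`. -/
def cost (ε : ℝ) (i : Fin p) : Fin (d i + 1) → ℝ := S.c i + ε • S.cbar i

def primalFeasible : Set (BlockVec d) :=
  {x | ∑ i, S.A i *ᵥ x i = S.b ∧ ∀ i, x i ∈ soc (d i)}

def dualFeasible (ε : ℝ) : Set ((Fin m → ℝ) × BlockVec d) :=
  {q | (∀ i, (S.A i)ᵀ *ᵥ q.1 + q.2 i = S.cost ε i) ∧ ∀ i, q.2 i ∈ soc (d i)}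

def primalObj (ε : ℝ) (x : BlockVec d) : ℝ := ∑ i, S.cost ε i ⬝ᵥ x i

/-- The optimal value function, with values in the extended reals. -/
def optVal (ε : ℝ) : EReal := ⨅ x ∈ S.primalFeasible, ((S.primalObj ε x : ℝ) : EReal)

/-- The domain of the optimal value function. -/
def dom : Set ℝ := {ε | ⊥ < S.optVal ε}

/-- The primal optimal set. -/
def primalOpt (ε : ℝ) : Set (BlockVec d) :=
  {x | ((S.primalObj ε x : ℝ) : EReal) = S.optVal ε ∧ x ∈ S.primalFeasible}

/-- The dual optimal set: dual feasible points whose objective is the primal optimal value. -/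
def dualOpt (ε : ℝ) : Set ((Fin m → ℝ) × BlockVec d) :=
  {q | ((S.b ⬝ᵥ q.1 : ℝ) : EReal) = S.optVal ε ∧ q ∈ S.dualFeasible ε}

/-- The interior point condition at `ε = 0`. -/
def InteriorPointCondition : Prop :=
  (∃ x ∈ S.primalFeasible, ∀ i, x i ∈ socInt (d i)) ∧
    ∃ q ∈ S.dualFeasible 0, ∀ i, q.2 i ∈ socInt (d i)

/-- Maximally complementary solutions: points of the relative interiors of the optimal sets. -/
def IsMaxCompl (ε : ℝ) (x : BlockVec d) (y : Fin m → ℝ) (s : BlockVec d) : Prop :=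
  x ∈ intrinsicInterior ℝ (S.primalOpt ε) ∧ (y, s) ∈ intrinsicInterior ℝ (S.dualOpt ε)

open Classical in
/-- The optimal partition at `ε`. -/
def partition (ε : ℝ) : ConePartition p where
  B := Finset.univ.filter fun i => ∃ x ∈ S.primalOpt ε, tailNorm (x i) < x i 0
  N := Finset.univ.filter fun i => ∃ q ∈ S.dualOpt ε, tailNorm (q.2 i) < q.2 i 0
  R := Finset.univ.filter fun i => ∃ x ∈ S.primalOpt ε, ∃ q ∈ S.dualOpt ε,
    (x i 0 = tailNorm (x i) ∧ 0 < tailNorm (x i)) ∧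
      (q.2 i 0 = tailNorm (q.2 i) ∧ 0 < tailNorm (q.2 i))
  T1 := Finset.univ.filter fun i => ∀ x ∈ S.primalOpt ε, ∀ q ∈ S.dualOpt ε, x i = 0 ∧ q.2 i = 0
  T2 := Finset.univ.filter fun i => (∀ q ∈ S.dualOpt ε, q.2 i = 0) ∧
    ∃ x ∈ S.primalOpt ε, x i 0 = tailNorm (x i) ∧ 0 < tailNorm (x i)
  T3 := Finset.univ.filter fun i => (∀ x ∈ S.primalOpt ε, x i = 0) ∧
    ∃ q ∈ S.dualOpt ε, q.2 i 0 = tailNorm (q.2 i) ∧ 0 < tailNorm (q.2 i)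

/-- The matrix `((A^i P^i)_{R ∪ T₂}, (A^i)_B)`. -/
def primalNondegMat (ε : ℝ) (P : ∀ i : Fin p, Matrix (Fin (d i + 1)) (Fin (d i)) ℝ) :
    Matrix (Fin m)
      ((Σ i : {i // i ∈ (S.partition ε).R ∪ (S.partition ε).T2}, Fin (d i)) ⊕
        (Σ i : {i // i ∈ (S.partition ε).B}, Fin (d i + 1))) ℝ :=
  Matrix.of fun r => Sum.elim (fun a => (S.A a.1 * P a.1) r a.2) (fun a => S.A a.1 r a.2)

/-- Primal nondegeneracy of `x`: the matrix `((A^i P^i)_{R ∪ T₂}, (A^i)_B)` has full row rank, where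
the `n_i - 1` columns of `P^i` are orthonormal eigenvectors for the positive eigenvalues of
`L(x^i)`. -/
def IsPrimalNondeg (ε : ℝ) (x : BlockVec d) : Prop :=
  ∃ P : ∀ i : Fin p, Matrix (Fin (d i + 1)) (Fin (d i)) ℝ,
    (∀ i ∈ (S.partition ε).R ∪ (S.partition ε).T2,
      (P i)ᵀ * P i = 1 ∧
        ∀ k, ∃ μ : ℝ, 0 < μ ∧ arrowMat (x i) *ᵥ (P i).col k = μ • (P i).col k) ∧
    LinearIndependent ℝ (S.primalNondegMat ε P).row

/-- The matrix `((A^i R^i s^i)_{R ∪ T₃}, (A^i)_{B ∪ T₁ ∪ T₂})`. -/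
def dualNondegMat (ε : ℝ) (s : BlockVec d) :
    Matrix (Fin m)
      ({i // i ∈ (S.partition ε).R ∪ (S.partition ε).T3} ⊕
        (Σ i : {i // i ∈ (S.partition ε).B ∪ (S.partition ε).T1 ∪ (S.partition ε).T2},
          Fin (d i + 1))) ℝ :=
  Matrix.of fun r =>
    Sum.elim (fun i => (S.A i *ᵥ (reflMat (d i) *ᵥ s i)) r) (fun a => S.A a.1 r a.2)

/-- Dual nondegeneracy of `(y, s)`: the matrix `((A^i R^i s^i)_{R ∪ T₃}, (A^i)_{B ∪ T₁ ∪ T₂})` has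
full column rank. -/
def IsDualNondeg (ε : ℝ) (s : BlockVec d) : Prop :=
  LinearIndependent ℝ (S.dualNondegMat ε s).col

/-- Both nondegeneracy conditions hold at `ε`: there is a maximally complementary solution that is
primal and dual nondegenerate. -/
def NondegenerateAt (ε : ℝ) : Prop :=
  ∃ x y s, S.IsMaxCompl ε x y s ∧ S.IsPrimalNondeg ε x ∧ S.IsDualNondeg ε s

/-- The optimal partition is the same at all points of `J`. -/
def PartitionConstOn (J : Set ℝ) : Prop :=
  ∀ ε₁ ∈ J, ∀ ε₂ ∈ J, S.partition ε₁ = S.partition ε₂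

/-- The extreme rays `ℝ₊ x^{*i}(ε)`, `i ∈ R ∪ T₂`, and `ℝ₊ s^{*i}(ε)`, `i ∈ R ∪ T₃`, do not vary
with `ε ∈ J`. -/
def RaysConstOn (J : Set ℝ) : Prop :=
  ∀ ε₁ ∈ J, ∀ ε₂ ∈ J, ∀ x₁ y₁ s₁ x₂ y₂ s₂,
    S.IsMaxCompl ε₁ x₁ y₁ s₁ → S.IsMaxCompl ε₂ x₂ y₂ s₂ →
      (∀ i ∈ (S.partition ε₁).R ∪ (S.partition ε₁).T2, nonnegRay (x₁ i) = nonnegRay (x₂ i)) ∧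
      (∀ i ∈ (S.partition ε₁).R ∪ (S.partition ε₁).T3, nonnegRay (s₁ i) = nonnegRay (s₂ i))

/-- An invariancy interval: a nonempty open subinterval of `int(dom)` on which the optimal
partition and the extreme rays are invariant. -/
def IsInvariancyInterval (J : Set ℝ) : Prop :=
  J.Nonempty ∧ IsOpen J ∧ J.OrdConnected ∧ J ⊆ interior S.dom ∧
    S.PartitionConstOn J ∧ S.RaysConstOn J

/-- A nonlinearity interval: a maximal nonempty open subinterval of `int(dom)` with a constant
optimal partition, on which some extreme ray varies. -/
def IsNonlinearityInterval (J : Set ℝ) : Prop :=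
  J.Nonempty ∧ IsOpen J ∧ J.OrdConnected ∧ J ⊆ interior S.dom ∧
    S.PartitionConstOn J ∧ ¬ S.RaysConstOn J ∧
    ∀ J' : Set ℝ, IsOpen J' → J'.OrdConnected → J' ⊆ interior S.dom → S.PartitionConstOn J' →
      J ⊆ J' → J' = J

/-- The optimal partition is constant near `ε₀`. -/
def PartitionConstNear (ε₀ : ℝ) : Prop :=
  ∃ δ : ℝ, 0 < δ ∧ Ioo (ε₀ - δ) (ε₀ + δ) ⊆ interior S.dom ∧
    ∀ ε ∈ Ioo (ε₀ - δ) (ε₀ + δ), S.partition ε = S.partition ε₀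

/-- The feasible set of the nonlinear reformulation `(DN_ε)` of the dual problem, written for the
index sets `P`. -/
def dnFeasible (P : ConePartition p) (ε : ℝ) : Set ((Fin m → ℝ) × SlackVec d P) :=
  {q | (∀ i ∈ P.B ∪ P.T1 ∪ P.T2, (S.A i)ᵀ *ᵥ q.1 = S.cost ε i) ∧
    (∀ i : {i // i ∈ P.slackIdx}, (S.A i)ᵀ *ᵥ q.1 + q.2 i = S.cost ε i) ∧
    (∀ i : {i // i ∈ P.slackIdx}, i.1 ∈ P.quadIdx →
      q.2 i ⬝ᵥ (reflMat (d i) *ᵥ q.2 i) = 0 ∧ 0 < q.2 i 0) ∧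
    (∀ i : {i // i ∈ P.slackIdx}, i.1 ∈ P.N → q.2 i ∈ socInt (d i))}

/-- `(w, z)` is a globally optimal solution of `(DN_ε) : min {-bᵀ w}`. -/
def IsDNGlobalOpt (P : ConePartition p) (ε : ℝ) (w : Fin m → ℝ) (z : SlackVec d P) : Prop :=
  (w, z) ∈ S.dnFeasible P ε ∧ ∀ q ∈ S.dnFeasible P ε, -(S.b ⬝ᵥ w) ≤ -(S.b ⬝ᵥ q.1)

/-- The mapping `G((w; z; u; v), ε)` of the first-order optimality conditions of `(DN_ε)`. Its four
groups of components are `-∑ A^i u^i - b`; then `-u^i - 2 v_i R^i z^i` for `i ∈ R ∪ T₃` and `-u^i`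
for `i ∈ N`; then `(A^i)ᵀ w + z^i - c^i - ε c̄^i` for `i ∈ R ∪ N ∪ T₃` and
`(A^i)ᵀ w - c^i - ε c̄^i` for the remaining `i`, that is `i ∈ B ∪ T₁ ∪ T₂`; and
`(z^i)ᵀ R^i z^i` for `i ∈ R ∪ T₃`. -/
def kktMap (P : ConePartition p) (q : KKTVar m d P) (ε : ℝ) : KKTVar m d P :=
  (-(∑ i, S.A i *ᵥ q.u i) - S.b,
   (fun i => if h : i.1 ∈ P.quadIdx
      then -q.u i - (2 * q.v ⟨i.1, h⟩) • (reflMat (d i) *ᵥ q.z i)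
      else -q.u i),
   (fun i => if h : i ∈ P.slackIdx
      then (S.A i)ᵀ *ᵥ q.w + q.z ⟨i, h⟩ - S.cost ε i
      else (S.A i)ᵀ *ᵥ q.w - S.cost ε i),
   (fun i => q.z ⟨i.1, ConePartition.mem_slackIdx_of_mem_quadIdx i.2⟩ ⬝ᵥ
      (reflMat (d i) *ᵥ q.z ⟨i.1, ConePartition.mem_slackIdx_of_mem_quadIdx i.2⟩)))

/-- `χ` is a real analytic solution map of `G = 0` on `(ε₀ - ρ, ε₀ + ρ)`, for the index sets of the
optimal partition at `ε₀`, whose value at `ε₀` consists of a globally optimal solution of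
`(DN_{ε₀})` and its Lagrange multipliers. -/
def IsSolutionMap (ε₀ ρ : ℝ) (χ : ℝ → KKTVar m d (S.partition ε₀)) : Prop :=
  0 < ρ ∧ AnalyticOnNhd ℝ χ (Ioo (ε₀ - ρ) (ε₀ + ρ)) ∧
    (∀ ε ∈ Ioo (ε₀ - ρ) (ε₀ + ρ), S.kktMap (S.partition ε₀) (χ ε) ε = 0) ∧
    S.IsDNGlobalOpt (S.partition ε₀) ε₀ (χ ε₀).w (χ ε₀).z

/-- All derivatives of order `k ≥ 1` vanish at `ε₀` for the functions `u^i_j` (`i ∈ T₁`),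
`(u^i_1)² - ‖u^i_{2:n_i}‖²` (`i ∈ T₂`) and `v_i` (`i ∈ T₃`). -/
def DerivativesVanish (ε₀ : ℝ) (χ : ℝ → KKTVar m d (S.partition ε₀)) : Prop :=
  (∀ i ∈ (S.partition ε₀).T1, ∀ j, ∀ k : ℕ, 1 ≤ k →
    iteratedDeriv k (fun ε => (χ ε).u i j) ε₀ = 0) ∧
  (∀ i ∈ (S.partition ε₀).T2, ∀ k : ℕ, 1 ≤ k →
    iteratedDeriv k (fun ε => (χ ε).u i 0 ^ 2 - tailNorm ((χ ε).u i) ^ 2) ε₀ = 0) ∧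
  (∀ (i : Fin p) (h : i ∈ (S.partition ε₀).T3), ∀ k : ℕ, 1 ≤ k →
    iteratedDeriv k (fun ε => (χ ε).v ⟨i, ConePartition.mem_quadIdx_of_mem_T3 h⟩) ε₀ = 0)

end ParamSOCO

end

/-! Nondegeneracy enters only through two kernel conditions. `PrimalKer` says that a vector h
vanishes if (A^i)ᵀh is zero on B and parallel to R x^i on R ∪ T2. `DualKer` says that a block vector
in the kernel of A vanishes if it is zero on N and parallel to R s^i on R ∪ T3. Complementarity with
a nonzero boundary point b of the cone forces a block to be a multiple of R b, so differences of
optimal solutions satisfy these hypotheses. Both optimal sets are therefore singletons.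

The solution (x; y; s) yields a zero of G with w = y, z = s, u = -x and 2v_i = x^i_1 / s^i_1
(`kktPoint`). The differential of G is injective there. Pairing a kernel direction with itself gives
a vanishing sum of nonnegative terms, because the Lorentz form is nonpositive on tangent hyperplanes
of the light cone. The equality case and the two kernel conditions then annihilate the direction
(`eq_zero_of_kktDeriv`). The implicit function theorem gives an analytic branch that contains every
zero of G near the base point.

If (∗) holds, analyticity makes the functions in it constant near the base parameter. The remaining
sign and kernel conditions are open, so the branch consists of nondegenerate solutions with an
unchanged block pattern, and uniqueness identifies the partition (`of_kktMap`,
`IsSolutionMap.partitionConstNear`). Conversely, suppose that the partition is constant nearby.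
Optimal solutions exist there, uniqueness and compactness keep them close to the base solution
(`IsSol.eventually_mem`), and constancy of the partition makes them zeros of G. They hence lie on
the branch, and the functions in (∗) vanish identically near the base parameter.

The statement on nonlinearity intervals follows by taking the union of all open intervals of
constancy through the point. If no ray varied on it, it would be an invariancy interval. -/

section Cone

/-! ### Geometry of the second-order cone: complementarity, tangent vectors, the arrow matrix -/

variable {k : ℕ}

theorem tailNorm_nonneg (a : Fin (k + 1) → ℝ) : 0 ≤ tailNorm a := Real.sqrt_nonneg _

theorem tailNorm_sq (a : Fin (k + 1) → ℝ) : tailNorm a ^ 2 = ∑ j : Fin k, a j.succ ^ 2 :=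
  Real.sq_sqrt (Finset.sum_nonneg fun _ _ => sq_nonneg _)

theorem continuous_tailNorm : Continuous (tailNorm : (Fin (k + 1) → ℝ) → ℝ) := by
  unfold tailNorm
  fun_prop

@[simp] theorem tailNorm_zero : tailNorm (0 : Fin (k + 1) → ℝ) = 0 := by
  simp [tailNorm]

/-- The nonzero boundary points of the second-order cone. -/
def SocBdry (a : Fin (k + 1) → ℝ) : Prop := a 0 = tailNorm a ∧ 0 < tailNorm a

theorem SocBdry.pos {a : Fin (k + 1) → ℝ} (h : SocBdry a) : 0 < a 0 := h.1 ▸ h.2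

theorem SocBdry.ne_zero {a : Fin (k + 1) → ℝ} (h : SocBdry a) : a ≠ 0 := by
  rintro rfl
  simpa using h.pos

theorem SocBdry.mem_soc {a : Fin (k + 1) → ℝ} (h : SocBdry a) : a ∈ soc k := h.1.ge

theorem eq_zero_of_mem_soc {a : Fin (k + 1) → ℝ} (h : a ∈ soc k) (h0 : a 0 ≤ 0) : a = 0 := by
  have h1 : tailNorm a ≤ a 0 := h
  have h2 := tailNorm_nonneg a
  have h3 : tailNorm a ^ 2 = 0 := by rw [le_antisymm (h1.trans h0) h2]; norm_num
  rw [tailNorm_sq, Finset.sum_eq_zero_iff_of_nonneg fun _ _ => sq_nonneg _] at h3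
  funext j
  refine Fin.cases ?_ (fun j => ?_) j
  · simp only [Pi.zero_apply]; linarith
  · simpa using h3 j (Finset.mem_univ _)

theorem soc_trichotomy {a : Fin (k + 1) → ℝ} (h : a ∈ soc k) :
    tailNorm a < a 0 ∨ SocBdry a ∨ a = 0 := by
  rcases lt_or_eq_of_le (show tailNorm a ≤ a 0 from h) with h1 | h1
  · exact Or.inl h1
  rcases lt_or_eq_of_le (tailNorm_nonneg a) with h2 | h2
  · exact Or.inr (Or.inl ⟨h1.symm, h2⟩)
  · exact Or.inr (Or.inr (eq_zero_of_mem_soc h (by linarith)))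

theorem SocBdry.not_int {a : Fin (k + 1) → ℝ} (h : SocBdry a) : ¬ tailNorm a < a 0 := by
  rw [h.1]; exact lt_irrefl _

theorem isClosed_soc : IsClosed (soc k) :=
  isClosed_le continuous_tailNorm (continuous_apply 0)

theorem isOpen_socInt : IsOpen (socInt k) :=
  isOpen_lt continuous_tailNorm (continuous_apply 0)

theorem dotProduct_eq_head_add (a b : Fin (k + 1) → ℝ) :
    a ⬝ᵥ b = a 0 * b 0 + ∑ j : Fin k, a j.succ * b j.succ := by
  rw [dotProduct, Fin.sum_univ_succ]

theorem abs_tail_sum_le (a b : Fin (k + 1) → ℝ) :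
    |∑ j : Fin k, a j.succ * b j.succ| ≤ tailNorm a * tailNorm b := by
  apply abs_le_of_sq_le_sq _ (mul_nonneg (tailNorm_nonneg a) (tailNorm_nonneg b))
  rw [mul_pow, tailNorm_sq, tailNorm_sq]
  exact Finset.sum_mul_sq_le_sq_mul_sq _ _ _

theorem tailNorm_add_le (a b : Fin (k + 1) → ℝ) :
    tailNorm (a + b) ≤ tailNorm a + tailNorm b := by
  apply (sq_le_sq₀ (tailNorm_nonneg _) (add_nonneg (tailNorm_nonneg a) (tailNorm_nonneg b))).1
  have h := (abs_le.1 (abs_tail_sum_le a b)).2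
  rw [add_sq, tailNorm_sq, tailNorm_sq, tailNorm_sq]
  simp only [Pi.add_apply, add_sq, Finset.sum_add_distrib]
  simp only [mul_assoc, ← Finset.mul_sum]
  linarith

theorem tailNorm_smul (t : ℝ) (a : Fin (k + 1) → ℝ) : tailNorm (t • a) = |t| * tailNorm a := by
  have : tailNorm (t • a) ^ 2 = (|t| * tailNorm a) ^ 2 := by
    rw [mul_pow, tailNorm_sq, tailNorm_sq, sq_abs, Finset.mul_sum]
    simp [mul_pow]
  exact (sq_eq_sq₀ (tailNorm_nonneg _) (mul_nonneg (abs_nonneg _) (tailNorm_nonneg _))).1 this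

theorem soc_add {a b : Fin (k + 1) → ℝ} (ha : a ∈ soc k) (hb : b ∈ soc k) : a + b ∈ soc k :=
  (tailNorm_add_le a b).trans (add_le_add ha hb)

theorem soc_smul {a : Fin (k + 1) → ℝ} {t : ℝ} (ht : 0 ≤ t) (ha : a ∈ soc k) : t • a ∈ soc k := by
  change tailNorm (t • a) ≤ t * a 0
  rw [tailNorm_smul, abs_of_nonneg ht]
  exact mul_le_mul_of_nonneg_left ha ht

theorem zero_mem_soc : (0 : Fin (k + 1) → ℝ) ∈ soc k := by
  simp [soc]

theorem soc_dotProduct_nonneg {a b : Fin (k + 1) → ℝ} (ha : a ∈ soc k) (hb : b ∈ soc k) :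
    0 ≤ a ⬝ᵥ b := by
  have h := (abs_le.1 (abs_tail_sum_le a b)).1
  have h1 := mul_le_mul (show tailNorm a ≤ a 0 from ha) (show tailNorm b ≤ b 0 from hb)
    (tailNorm_nonneg b) ((tailNorm_nonneg a).trans ha)
  rw [dotProduct_eq_head_add]
  linarith

/-- By Cauchy-Schwarz the product is at least (a_1 - ‖a_{2:n}‖) b_1, which is positive unless b_1 ≤
0. -/
theorem eq_zero_of_socInt_dotProduct {a b : Fin (k + 1) → ℝ} (ha : tailNorm a < a 0)
    (hb : b ∈ soc k) (h0 : a ⬝ᵥ b = 0) : b = 0 := by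
  have h := (abs_le.1 (abs_tail_sum_le a b)).1
  have h1 := mul_le_mul_of_nonneg_left (show tailNorm b ≤ b 0 from hb) (tailNorm_nonneg a)
  rw [dotProduct_eq_head_add] at h0
  apply eq_zero_of_mem_soc hb
  by_contra! h2
  have := mul_pos (sub_pos.2 ha) h2
  linarith

/-- The diagonal entries of `diag(1, -1, …, -1)`. -/
def reflSign (j : Fin (k + 1)) : ℝ := (Fin.cons 1 fun _ => -1 : Fin (k + 1) → ℝ) j

@[simp] theorem reflSign_zero : reflSign (0 : Fin (k + 1)) = 1 := rfl

@[simp] theorem reflSign_succ (j : Fin k) : reflSign j.succ = -1 := rfl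

theorem reflMat_mulVec (a : Fin (k + 1) → ℝ) (j : Fin (k + 1)) :
    (reflMat k *ᵥ a) j = reflSign j * a j := by
  rw [reflMat, Matrix.mulVec_diagonal]; rfl

theorem reflMat_mulVec_involutive (a : Fin (k + 1) → ℝ) :
    reflMat k *ᵥ (reflMat k *ᵥ a) = a := by
  funext j
  rw [reflMat_mulVec, reflMat_mulVec]
  refine Fin.cases ?_ (fun j => ?_) j <;> simp

theorem reflMat_mulVec_ne_zero {a : Fin (k + 1) → ℝ} (h : a ≠ 0) : reflMat k *ᵥ a ≠ 0 := by
  intro h0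
  apply h
  rw [← reflMat_mulVec_involutive a, h0, Matrix.mulVec_zero]

theorem dotProduct_reflMat (a b : Fin (k + 1) → ℝ) :
    a ⬝ᵥ (reflMat k *ᵥ b) = a 0 * b 0 - ∑ j : Fin k, a j.succ * b j.succ := by
  rw [dotProduct_eq_head_add]
  simp [reflMat_mulVec, sub_eq_add_neg]

theorem dotProduct_reflMat_comm (a b : Fin (k + 1) → ℝ) :
    a ⬝ᵥ (reflMat k *ᵥ b) = b ⬝ᵥ (reflMat k *ᵥ a) := by
  simp only [dotProduct_reflMat, mul_comm]

theorem dotProduct_reflMat_self (a : Fin (k + 1) → ℝ) :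
    a ⬝ᵥ (reflMat k *ᵥ a) = a 0 ^ 2 - tailNorm a ^ 2 := by
  rw [dotProduct_reflMat, tailNorm_sq]
  simp only [pow_two]

theorem SocBdry.dotProduct_reflMat_self {a : Fin (k + 1) → ℝ} (h : SocBdry a) :
    a ⬝ᵥ (reflMat k *ᵥ a) = 0 := by
  rw [_root_.dotProduct_reflMat_self, h.1, sub_self]

theorem socBdry_of_dotProduct_reflMat_self {a : Fin (k + 1) → ℝ}
    (h : a ⬝ᵥ (reflMat k *ᵥ a) = 0) (h0 : 0 < a 0) : SocBdry a := by
  rw [_root_.dotProduct_reflMat_self, sub_eq_zero, sq_eq_sq₀ h0.le (tailNorm_nonneg a)] at h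
  exact ⟨h, h ▸ h0⟩

/-- The weighted tail identity behind the equality cases of the Cauchy-Schwarz inequality. -/
theorem sum_sq_combination (a b : Fin (k + 1) → ℝ) (r t : ℝ) :
    ∑ j : Fin k, (r * a j.succ + t * b j.succ) ^ 2 =
      r ^ 2 * tailNorm a ^ 2 + 2 * r * t * (∑ j : Fin k, a j.succ * b j.succ) +
        t ^ 2 * tailNorm b ^ 2 := by
  rw [tailNorm_sq, tailNorm_sq, Finset.mul_sum, Finset.mul_sum, Finset.mul_sum,
    ← Finset.sum_add_distrib, ← Finset.sum_add_distrib]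
  exact Finset.sum_congr rfl fun j _ => by ring

/-- This is the equality case of Cauchy-Schwarz: the squared norm of the tail of b_1 a + a_1 b
equals b_1²(‖a_{2:n}‖² - a_1²), which is nonpositive on the cone. -/
theorem eq_smul_reflMat_of_dotProduct_eq_zero {a b : Fin (k + 1) → ℝ} (ha : a ∈ soc k)
    (hb : SocBdry b) (h0 : a ⬝ᵥ b = 0) : a = (a 0 / b 0) • (reflMat k *ᵥ b) := by
  have hb0 := hb.pos
  rw [dotProduct_eq_head_add] at h0
  have h1 := sum_sq_combination a b (b 0) (a 0)
  have h2 : tailNorm a ^ 2 ≤ a 0 ^ 2 := pow_le_pow_left₀ (tailNorm_nonneg a) ha 2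
  have h3 : ∑ j : Fin k, (b 0 * a j.succ + a 0 * b j.succ) ^ 2 ≤ 0 := by
    rw [h1, ← hb.1, show (∑ j : Fin k, a j.succ * b j.succ) = -(a 0 * b 0) by linarith]
    have := mul_le_mul_of_nonneg_left h2 (sq_nonneg (b 0))
    linarith
  have h4 := (Finset.sum_eq_zero_iff_of_nonneg fun _ _ => sq_nonneg _).1
    (le_antisymm h3 (Finset.sum_nonneg fun _ _ => sq_nonneg _))
  funext j
  rw [Pi.smul_apply, reflMat_mulVec, smul_eq_mul]
  refine Fin.cases ?_ (fun j => ?_) j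
  · simp [hb0.ne']
  · have h5 := pow_eq_zero_iff (two_ne_zero) |>.1 (h4 j (Finset.mem_univ _))
    simp only [reflSign_succ]
    field_simp
    linarith

/-- The left side is a sum of squares, so the Lorentz form is nonpositive on the hyperplane tangent
to the light cone at b, and it vanishes there only along b. The next two lemmas extract these two
facts. -/
theorem tangent_identity {b z : Fin (k + 1) → ℝ} (hb : SocBdry b)
    (h0 : b ⬝ᵥ (reflMat k *ᵥ z) = 0) :
    ∑ j : Fin k, (b 0 * z j.succ + -z 0 * b j.succ) ^ 2 =
      -(b 0 ^ 2 * (z ⬝ᵥ (reflMat k *ᵥ z))) := by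
  rw [dotProduct_reflMat_comm, dotProduct_reflMat] at h0
  rw [sum_sq_combination, ← hb.1, dotProduct_reflMat_self,
    show (∑ j : Fin k, z j.succ * b j.succ) = z 0 * b 0 by linarith]
  ring

theorem tangent_nonpos {b z : Fin (k + 1) → ℝ} (hb : SocBdry b)
    (h0 : b ⬝ᵥ (reflMat k *ᵥ z) = 0) : z ⬝ᵥ (reflMat k *ᵥ z) ≤ 0 := by
  have h1 := tangent_identity hb h0
  have h2 : 0 ≤ ∑ j : Fin k, (b 0 * z j.succ + -z 0 * b j.succ) ^ 2 :=
    Finset.sum_nonneg fun _ _ => sq_nonneg _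
  by_contra! h3
  have := mul_pos (pow_pos hb.pos 2) h3
  linarith

theorem tangent_eq_smul {b z : Fin (k + 1) → ℝ} (hb : SocBdry b)
    (h0 : b ⬝ᵥ (reflMat k *ᵥ z) = 0) (h1 : z ⬝ᵥ (reflMat k *ᵥ z) = 0) :
    z = (z 0 / b 0) • b := by
  have hb0 := hb.pos
  have h2 := tangent_identity hb h0
  rw [h1, mul_zero, neg_zero] at h2
  have h4 := (Finset.sum_eq_zero_iff_of_nonneg fun _ _ => sq_nonneg _).1 h2
  funext j
  rw [Pi.smul_apply, smul_eq_mul]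
  refine Fin.cases ?_ (fun j => ?_) j
  · field_simp
  · have h5 := pow_eq_zero_iff (two_ne_zero) |>.1 (h4 j (Finset.mem_univ _))
    field_simp
    linarith

/-- Proportionality, expressed by the vanishing of the `2 × 2` minors. -/
def Para {ι : Type*} (a b : ι → ℝ) : Prop := ∀ j l, a j * b l = a l * b j

theorem para_smul_self {ι : Type*} (t : ℝ) (b : ι → ℝ) : Para (t • b) b := by
  intro j l
  simp only [Pi.smul_apply, smul_eq_mul]
  ring

theorem Para.smul {ι : Type*} {a b : ι → ℝ} (h : Para a b) (t : ℝ) : Para (t • a) b := by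
  intro j l
  simp only [Pi.smul_apply, smul_eq_mul, mul_assoc, h j l]

theorem Para.exists_eq_smul {ι : Type*} {a b : ι → ℝ} (h : Para a b) (hb : b ≠ 0) :
    ∃ t : ℝ, a = t • b := by
  obtain ⟨l, hl⟩ := Function.ne_iff.1 hb
  rw [Pi.zero_apply] at hl
  refine ⟨a l / b l, funext fun j => ?_⟩
  have := h j l
  simp only [Pi.smul_apply, smul_eq_mul]
  field_simp
  linarith

/-- The first row gives the Lorentz form of a, which vanishes on the boundary; in the other rows a_j
a_1 cancels against a_1 (-a_j). -/
theorem arrowMat_mulVec_reflMat {a : Fin (k + 1) → ℝ} (h : SocBdry a) :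
    arrowMat a *ᵥ (reflMat k *ᵥ a) = 0 := by
  funext j
  rw [Matrix.mulVec]
  refine Fin.cases ?_ (fun j => ?_) j
  · have : (fun l => arrowMat a 0 l) = a := by funext l; simp [arrowMat]
    rw [this, h.dotProduct_reflMat_self]; rfl
  · have h0 : arrowMat a j.succ 0 = a j.succ := by simp [arrowMat]
    have h1 : ∀ l : Fin k, arrowMat a j.succ l.succ = if j = l then a 0 else 0 := by
      intro l
      simp only [arrowMat, Matrix.of_apply, Fin.succ_ne_zero, if_false, Fin.succ_inj]
    rw [dotProduct_eq_head_add, h0]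
    simp only [h1, reflMat_mulVec, reflSign_zero, reflSign_succ, ite_mul, zero_mul,
      Finset.sum_ite_eq, Finset.mem_univ, if_true, Pi.zero_apply]
    ring

theorem arrowMat_transpose (a : Fin (k + 1) → ℝ) : (arrowMat a)ᵀ = arrowMat a := by
  ext i j
  simp only [arrowMat, Matrix.transpose_apply, Matrix.of_apply, eq_comm (a := i) (b := j)]
  split_ifs <;> simp_all

/-- Eigenvectors of the arrow matrix for nonzero eigenvalues are orthogonal to its kernel. -/
theorem dotProduct_reflMat_eq_zero_of_eigen {a v : Fin (k + 1) → ℝ} {μ : ℝ} (h : SocBdry a)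
    (hμ : 0 < μ) (hv : arrowMat a *ᵥ v = μ • v) : v ⬝ᵥ (reflMat k *ᵥ a) = 0 := by
  have h1 : (arrowMat a *ᵥ v) ⬝ᵥ (reflMat k *ᵥ a) = 0 := by
    rw [dotProduct_comm, Matrix.dotProduct_mulVec, ← Matrix.mulVec_transpose, arrowMat_transpose,
      arrowMat_mulVec_reflMat h, zero_dotProduct]
  rw [hv, smul_dotProduct, smul_eq_mul] at h1
  exact (mul_eq_zero.1 h1).resolve_left hμ.ne'

end Cone

/-! ### Duality, the optimal partition, and nondegeneracy as trivial kernels -/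

namespace ParamSOCO

variable {m p : ℕ} {d : Fin p → ℕ} (S : ParamSOCO m p d)

/-- Complementary pairs of primal and dual feasible points. -/
def IsSol (ε : ℝ) (x : BlockVec d) (y : Fin m → ℝ) (s : BlockVec d) : Prop :=
  x ∈ S.primalFeasible ∧ (y, s) ∈ S.dualFeasible ε ∧ ∑ i, x i ⬝ᵥ s i = 0

variable {S} {ε : ℝ} {x : BlockVec d} {y : Fin m → ℝ} {s : BlockVec d}

theorem sum_dotProduct_transpose_mulVec (x : BlockVec d) (y : Fin m → ℝ) :
    ∑ i, x i ⬝ᵥ ((S.A i)ᵀ *ᵥ y) = (∑ i, S.A i *ᵥ x i) ⬝ᵥ y := by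
  rw [sum_dotProduct]
  refine Finset.sum_congr rfl fun i _ => ?_
  rw [Matrix.mulVec_transpose, dotProduct_comm, ← Matrix.dotProduct_mulVec, dotProduct_comm]

theorem sum_dotProduct_eq_gap (hx : ∑ i, S.A i *ᵥ x i = S.b)
    (hs : ∀ i, (S.A i)ᵀ *ᵥ y + s i = S.cost ε i) :
    ∑ i, x i ⬝ᵥ s i = S.primalObj ε x - S.b ⬝ᵥ y := by
  rw [← hx, ← sum_dotProduct_transpose_mulVec, primalObj, ← Finset.sum_sub_distrib]
  refine Finset.sum_congr rfl fun i _ => ?_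
  rw [← hs i, dotProduct_comm _ (x i), dotProduct_add]
  ring

theorem weak_duality (hx : x ∈ S.primalFeasible) (hq : (y, s) ∈ S.dualFeasible ε) :
    S.b ⬝ᵥ y ≤ S.primalObj ε x := by
  have h := sum_dotProduct_eq_gap hx.1 hq.1
  have h1 : 0 ≤ ∑ i, x i ⬝ᵥ s i :=
    Finset.sum_nonneg fun i _ => soc_dotProduct_nonneg (hx.2 i) (hq.2 i)
  linarith

theorem le_optVal (hq : (y, s) ∈ S.dualFeasible ε) : ((S.b ⬝ᵥ y : ℝ) : EReal) ≤ S.optVal ε :=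
  le_iInf₂ fun _ hx => EReal.coe_le_coe_iff.2 (weak_duality hx hq)

theorem optVal_le (hx : x ∈ S.primalFeasible) : S.optVal ε ≤ ((S.primalObj ε x : ℝ) : EReal) :=
  iInf₂_le x hx

theorem IsSol.primalObj_eq (h : S.IsSol ε x y s) : S.primalObj ε x = S.b ⬝ᵥ y := by
  have := sum_dotProduct_eq_gap h.1.1 h.2.1.1
  rw [h.2.2] at this
  linarith

theorem IsSol.mem_primalOpt (h : S.IsSol ε x y s) : x ∈ S.primalOpt ε := by
  refine ⟨le_antisymm ?_ (optVal_le h.1), h.1⟩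
  rw [h.primalObj_eq]
  exact le_optVal h.2.1

theorem IsSol.mem_dualOpt (h : S.IsSol ε x y s) : (y, s) ∈ S.dualOpt ε := by
  refine ⟨?_, h.2.1⟩
  rw [← h.mem_primalOpt.1, h.primalObj_eq]

theorem IsSol.mem_dom (h : S.IsSol ε x y s) : ε ∈ S.dom := by
  change ⊥ < S.optVal ε
  rw [← h.mem_primalOpt.1]
  exact EReal.bot_lt_coe _

/-- Dual optimality is measured against the primal optimal value, so the gap is zero by definition
and no strong duality theorem is needed. -/
theorem isSol_of_mem_opt (hx : x ∈ S.primalOpt ε) (hq : (y, s) ∈ S.dualOpt ε) :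
    S.IsSol ε x y s := by
  refine ⟨hx.2, hq.2, ?_⟩
  rw [sum_dotProduct_eq_gap hx.2.1 hq.2.1, EReal.coe_eq_coe_iff.1 (hx.1.trans hq.1.symm), sub_self]

theorem IsSol.dotProduct_eq_zero (h : S.IsSol ε x y s) (i : Fin p) : x i ⬝ᵥ s i = 0 :=
  (Finset.sum_eq_zero_iff_of_nonneg fun i _ =>
    soc_dotProduct_nonneg (h.1.2 i) (h.2.1.2 i)).1 h.2.2 i (Finset.mem_univ i)

theorem complementary_of_mem_opt (hx : x ∈ S.primalOpt ε) (hq : (y, s) ∈ S.dualOpt ε)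
    (i : Fin p) : x i ⬝ᵥ s i = 0 := (isSol_of_mem_opt hx hq).dotProduct_eq_zero i

/-- The index sets `P` describe the positions of the blocks of `x` and `s`. -/
structure HasPattern (P : ConePartition p) (x s : BlockVec d) : Prop where
  B : ∀ i, i ∈ P.B ↔ tailNorm (x i) < x i 0
  N : ∀ i, i ∈ P.N ↔ tailNorm (s i) < s i 0
  R : ∀ i, i ∈ P.R ↔ SocBdry (x i) ∧ SocBdry (s i)
  T1 : ∀ i, i ∈ P.T1 ↔ x i = 0 ∧ s i = 0
  T2 : ∀ i, i ∈ P.T2 ↔ s i = 0 ∧ SocBdry (x i)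
  T3 : ∀ i, i ∈ P.T3 ↔ x i = 0 ∧ SocBdry (s i)

theorem partition_eq_of_unique {P : ConePartition p} (hP : HasPattern P x s)
    (hx : x ∈ S.primalOpt ε) (hq : (y, s) ∈ S.dualOpt ε)
    (ux : ∀ x' ∈ S.primalOpt ε, x' = x) (uq : ∀ q ∈ S.dualOpt ε, q = (y, s)) :
    S.partition ε = P := by
  have e1 : S.primalOpt ε = {x} := Set.eq_singleton_iff_unique_mem.2 ⟨hx, ux⟩
  have e2 : S.dualOpt ε = {(y, s)} := Set.eq_singleton_iff_unique_mem.2 ⟨hq, uq⟩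
  unfold partition
  apply ConePartition.ext <;> ext i
  · simp [e1, hP.B]
  · simp [e2, hP.N]
  · simp [e1, e2, hP.R, SocBdry]
  · simp [e1, e2, hP.T1]
  · simp [e1, e2, hP.T2, SocBdry]
  · simp [e1, e2, hP.T3, SocBdry]

theorem hasPattern_partition (hx : x ∈ S.primalOpt ε) (hq : (y, s) ∈ S.dualOpt ε)
    (ux : ∀ x' ∈ S.primalOpt ε, x' = x) (uq : ∀ q ∈ S.dualOpt ε, q = (y, s)) :
    HasPattern (S.partition ε) x s := by
  have e1 : S.primalOpt ε = {x} := Set.eq_singleton_iff_unique_mem.2 ⟨hx, ux⟩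
  have e2 : S.dualOpt ε = {(y, s)} := Set.eq_singleton_iff_unique_mem.2 ⟨hq, uq⟩
  constructor <;> intro i <;> simp [partition, e1, e2, SocBdry]

/-- Outside B and N every nonzero optimal block is a boundary point, so only the vanishing of the
primal and dual blocks has to be distinguished. A primal and a dual witness can be chosen
independently for R. Empty optimal sets cause no trouble, since T1 then contains every index. -/
theorem partition_cover (i : Fin p) :
    i ∈ (S.partition ε).N ∨ i ∈ (S.partition ε).R ∪ (S.partition ε).T3 ∨
      i ∈ (S.partition ε).B ∪ (S.partition ε).T1 ∪ (S.partition ε).T2 := by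
  classical
  by_cases hB : ∃ x ∈ S.primalOpt ε, tailNorm (x i) < x i 0
  · right; right; simp [partition, hB]
  by_cases hN : ∃ q ∈ S.dualOpt ε, tailNorm (q.2 i) < q.2 i 0
  · left; simp [partition]; simpa using hN
  push Not at hB hN
  have tx : ∀ x ∈ S.primalOpt ε, x i ≠ 0 → SocBdry (x i) := fun x hx h0 =>
    ((soc_trichotomy (hx.2.2 i)).resolve_left (hB x hx).not_gt).resolve_right h0
  have ts : ∀ q ∈ S.dualOpt ε, q.2 i ≠ 0 → SocBdry (q.2 i) := fun q hq h0 =>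
    ((soc_trichotomy (hq.2.2 i)).resolve_left (hN q hq).not_gt).resolve_right h0
  by_cases hX : ∀ x ∈ S.primalOpt ε, x i = 0 <;> by_cases hS : ∀ q ∈ S.dualOpt ε, q.2 i = 0
  · right; right
    refine Finset.mem_union_left _ (Finset.mem_union_right _ ?_)
    exact Finset.mem_filter.2 ⟨Finset.mem_univ _, fun x hx q hq => ⟨hX x hx, hS q hq⟩⟩
  · right; left
    push Not at hS
    obtain ⟨q, hq, h⟩ := hS
    refine Finset.mem_union_right _ ?_
    exact Finset.mem_filter.2 ⟨Finset.mem_univ _, hX, q, hq, ts q hq h⟩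
  · right; right
    push Not at hX
    obtain ⟨x, hx, h⟩ := hX
    refine Finset.mem_union_right _ ?_
    exact Finset.mem_filter.2 ⟨Finset.mem_univ _, hS, x, hx, tx x hx h⟩
  · right; left
    push Not at hX hS
    obtain ⟨q, hq, h⟩ := hS
    obtain ⟨x, hx, h'⟩ := hX
    refine Finset.mem_union_left _ ?_
    exact Finset.mem_filter.2 ⟨Finset.mem_univ _, x, hx, q, hq, tx x hx h', ts q hq h⟩

variable (S) in
/-- Primal nondegeneracy in terms of the kernel of the constraint map on the normal directions. -/
def PrimalKer (P : ConePartition p) (x : BlockVec d) : Prop :=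
  ∀ h : Fin m → ℝ, (∀ i ∈ P.B, (S.A i)ᵀ *ᵥ h = 0) →
    (∀ i ∈ P.R ∪ P.T2, Para ((S.A i)ᵀ *ᵥ h) (reflMat (d i) *ᵥ x i)) → h = 0

variable (S) in
/-- Dual nondegeneracy in terms of the kernel of the constraint map. -/
def DualKer (P : ConePartition p) (s : BlockVec d) : Prop :=
  ∀ h : BlockVec d, ∑ i, S.A i *ᵥ h i = 0 → (∀ i ∈ P.N, h i = 0) →
    (∀ i ∈ P.R ∪ P.T3, Para (h i) (reflMat (d i) *ᵥ s i)) → h = 0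

theorem exists_smul_of_complementary {k : ℕ} {a b : Fin (k + 1) → ℝ} (ha : a ∈ soc k)
    (hb : b ∈ soc k) (hb0 : b ≠ 0) (h : a ⬝ᵥ b = 0) : ∃ t : ℝ, a = t • (reflMat k *ᵥ b) := by
  rcases soc_trichotomy hb with h1 | h1 | h1
  · refine ⟨0, ?_⟩
    rw [zero_smul]
    exact eq_zero_of_socInt_dotProduct h1 ha (by rwa [dotProduct_comm])
  · exact ⟨_, eq_smul_reflMat_of_dotProduct_eq_zero ha h1 h⟩
  · exact absurd h1 hb0

theorem para_sub_of_complementary {k : ℕ} {a a' b : Fin (k + 1) → ℝ} (ha : a ∈ soc k)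
    (ha' : a' ∈ soc k) (hb : b ∈ soc k) (hb0 : b ≠ 0) (h : a ⬝ᵥ b = 0) (h' : a' ⬝ᵥ b = 0) :
    Para (a' - a) (reflMat k *ᵥ b) := by
  obtain ⟨t, ht⟩ := exists_smul_of_complementary ha hb hb0 h
  obtain ⟨t', ht'⟩ := exists_smul_of_complementary ha' hb hb0 h'
  rw [ht, ht', ← sub_smul]
  exact para_smul_self _ _

/-- The difference of two primal optima lies in the kernel described by `DualKer`: both blocks
vanish on N, and both are multiples of R s^i on R ∪ T3. -/
theorem primalOpt_unique {P : ConePartition p} (hD : S.DualKer P s)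
    (hq : (y, s) ∈ S.dualOpt ε) (hN : ∀ i ∈ P.N, ∃ q ∈ S.dualOpt ε, tailNorm (q.2 i) < q.2 i 0)
    (hs : ∀ i ∈ P.R ∪ P.T3, s i ≠ 0) {x' : BlockVec d} (hx : x ∈ S.primalOpt ε)
    (hx' : x' ∈ S.primalOpt ε) : x' = x := by
  apply sub_eq_zero.1
  apply hD
  · simp only [Pi.sub_apply, Matrix.mulVec_sub, Finset.sum_sub_distrib]
    rw [hx'.2.1, hx.2.1, sub_self]
  · intro i hi
    obtain ⟨q, hq, h⟩ := hN i hi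
    have h1 := complementary_of_mem_opt hx hq i
    have h2 := complementary_of_mem_opt hx' hq i
    rw [dotProduct_comm] at h1 h2
    rw [Pi.sub_apply, eq_zero_of_socInt_dotProduct h (hx.2.2 i) h1,
      eq_zero_of_socInt_dotProduct h (hx'.2.2 i) h2, sub_zero]
  · intro i hi
    exact para_sub_of_complementary (hx.2.2 i) (hx'.2.2 i) (hq.2.2 i) (hs i hi)
      (complementary_of_mem_opt hx hq i) (complementary_of_mem_opt hx' hq i)

/-- The same argument applies to y - y', because (A^i)ᵀ(y - y') is the difference of the slack
blocks. -/
theorem dualOpt_unique {P : ConePartition p} (hD : S.PrimalKer P x)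
    (hx : x ∈ S.primalOpt ε) (hB : ∀ i ∈ P.B, ∃ x ∈ S.primalOpt ε, tailNorm (x i) < x i 0)
    (h0 : ∀ i ∈ P.R ∪ P.T2, x i ≠ 0) {q : (Fin m → ℝ) × BlockVec d} (hq : (y, s) ∈ S.dualOpt ε)
    (hq' : q ∈ S.dualOpt ε) : q = (y, s) := by
  obtain ⟨y', s'⟩ := q
  have key : ∀ i, (S.A i)ᵀ *ᵥ (y - y') = s' i - s i := by
    intro i
    have h1 : (S.A i)ᵀ *ᵥ y + s i = S.cost ε i := hq.2.1 i
    have h2 : (S.A i)ᵀ *ᵥ y' + s' i = S.cost ε i := hq'.2.1 i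
    rw [Matrix.mulVec_sub, sub_eq_sub_iff_add_eq_add]
    exact (h1.trans h2.symm).trans (add_comm _ _)
  have hy : y - y' = 0 := by
    apply hD
    · intro i hi
      obtain ⟨x, hx, h⟩ := hB i hi
      have e1 : s i = 0 :=
        eq_zero_of_socInt_dotProduct h (hq.2.2 i) (complementary_of_mem_opt hx hq i)
      have e2 : s' i = 0 :=
        eq_zero_of_socInt_dotProduct h (hq'.2.2 i) (complementary_of_mem_opt hx hq' i)
      rw [key, e1, e2, sub_zero]
    · intro i hi
      rw [key]
      refine para_sub_of_complementary (hq.2.2 i) (hq'.2.2 i) (hx.2.2 i) (h0 i hi) ?_ ?_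
      · rw [dotProduct_comm]; exact complementary_of_mem_opt hx hq i
      · rw [dotProduct_comm]; exact complementary_of_mem_opt hx hq' i
  refine Prod.ext (sub_eq_zero.1 hy).symm (funext fun i => ?_)
  have := key i
  rw [hy, Matrix.mulVec_zero] at this
  exact sub_eq_zero.1 this.symm

/-- Such an h is a left null vector of the nondegeneracy matrix. On R ∪ T2 the vector (A^i)ᵀh is a
multiple of R x^i, which lies in the kernel of the symmetric matrix L(x^i) and is thus orthogonal to
the columns of P^i. -/
theorem primalKer_of_isPrimalNondeg (h : S.IsPrimalNondeg ε x)
    (hx : ∀ i ∈ (S.partition ε).R ∪ (S.partition ε).T2, SocBdry (x i)) :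
    S.PrimalKer (S.partition ε) x := by
  obtain ⟨P, hP, hli⟩ := h
  rw [← Matrix.vecMul_injective_iff] at hli
  intro h hB hR
  apply hli
  simp only [Matrix.zero_vecMul]
  funext c
  rcases c with ⟨⟨i, hi⟩, k⟩ | ⟨⟨i, hi⟩, k⟩
  · obtain ⟨t, ht⟩ := (hR i hi).exists_eq_smul (reflMat_mulVec_ne_zero (hx i hi).ne_zero)
    obtain ⟨μ, hμ, hv⟩ := (hP i hi).2 k
    have h1 := dotProduct_reflMat_eq_zero_of_eigen (hx i hi) hμ hv
    have h2 : (h ᵥ* (S.A i * P i)) k = 0 := by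
      rw [← Matrix.vecMul_vecMul, ← Matrix.mulVec_transpose (S.A i), ht]
      change _ ⬝ᵥ (P i).col k = 0
      rw [dotProduct_comm, dotProduct_smul, h1, smul_zero]
    exact h2
  · have h2 : (h ᵥ* S.A i) k = 0 := by
      rw [← Matrix.mulVec_transpose, hB i hi]; rfl
    exact h2

theorem dualKer_of_isDualNondeg (h : S.IsDualNondeg ε s)
    (hcov : ∀ i, i ∈ (S.partition ε).N ∨ i ∈ (S.partition ε).R ∪ (S.partition ε).T3 ∨
      i ∈ (S.partition ε).B ∪ (S.partition ε).T1 ∪ (S.partition ε).T2)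
    (hs : ∀ i ∈ (S.partition ε).R ∪ (S.partition ε).T3, s i ≠ 0) :
    S.DualKer (S.partition ε) s := by
  classical
  unfold IsDualNondeg at h
  rw [← Matrix.mulVec_injective_iff] at h
  intro g hg hN hR
  set P := S.partition ε with hPdef
  set K := P.B ∪ P.T1 ∪ P.T2 with hK
  have ht : ∀ i, ∃ t : ℝ, i ∉ K → i ∈ P.R ∪ P.T3 → g i = t • (reflMat (d i) *ᵥ s i) := by
    intro i
    by_cases hi : i ∈ P.R ∪ P.T3
    · obtain ⟨t, ht⟩ := (hR i hi).exists_eq_smul (reflMat_mulVec_ne_zero (hs i hi))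
      exact ⟨t, fun _ _ => ht⟩
    · exact ⟨0, fun _ h => absurd h hi⟩
  choose t ht using ht
  -- The index sets are not yet known to be disjoint. Blocks with index in K are accounted for by
  -- the full columns, so their coefficient among the R ∪ T3 columns is set to 0 to avoid counting
  -- them twice.
  let G : ({i // i ∈ P.R ∪ P.T3} ⊕ (Σ i : {i // i ∈ K}, Fin (d i + 1))) → ℝ :=
    Sum.elim (fun i => if i.1 ∈ K then 0 else t i.1) (fun a => g a.1.1 a.2)
  have hG : S.dualNondegMat ε s *ᵥ G = 0 := by
    funext r
    rw [Matrix.mulVec, dotProduct, Fintype.sum_sum_type]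
    simp only [G, dualNondegMat, Matrix.of_apply, Sum.elim_inl, Sum.elim_inr, Fintype.sum_sigma]
    have e1 : (∑ i : {i // i ∈ P.R ∪ P.T3}, (S.A i.1 *ᵥ (reflMat (d i.1) *ᵥ s i.1)) r *
        (if i.1 ∈ K then 0 else t i.1)) =
        ∑ i, if i ∈ P.R ∪ P.T3 then (S.A i *ᵥ (reflMat (d i) *ᵥ s i)) r *
          (if i ∈ K then 0 else t i) else 0 := by
      rw [← Finset.sum_filter, Finset.filter_mem_eq_inter, Finset.univ_inter]
      exact Finset.sum_coe_sort (P.R ∪ P.T3)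
        (fun i => (S.A i *ᵥ (reflMat (d i) *ᵥ s i)) r * (if i ∈ K then 0 else t i))
    have e2 : (∑ i : {i // i ∈ K}, ∑ j, S.A i.1 r j * g i.1 j) =
        ∑ i, if i ∈ K then (S.A i *ᵥ g i) r else 0 := by
      rw [← Finset.sum_filter, Finset.filter_mem_eq_inter, Finset.univ_inter]
      exact Finset.sum_coe_sort K (fun i => (S.A i *ᵥ g i) r)
    refine (congrArg₂ (· + ·) e1 e2).trans ?_
    rw [← Finset.sum_add_distrib]
    have e3 : (∑ i, (S.A i *ᵥ g i) r) = 0 := by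
      have := congrFun hg r
      rwa [Finset.sum_apply] at this
    refine Eq.trans ?_ e3
    refine Finset.sum_congr rfl fun i _ => ?_
    by_cases hi : i ∈ K
    · simp [hi]
    by_cases hi' : i ∈ P.R ∪ P.T3
    · rw [if_pos hi', if_neg hi, if_neg hi, ht i hi hi', Matrix.mulVec_smul]
      simp [mul_comm]
    · have : i ∈ P.N := by
        rcases hcov i with h | h | h
        · exact h
        · exact absurd h hi'
        · exact absurd h hi
      rw [if_neg hi', if_neg hi, hN i this, Matrix.mulVec_zero]
      simp
  have hG0 : G = 0 := h (hG.trans (Matrix.mulVec_zero _).symm)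
  funext i
  by_cases hi : i ∈ K
  · funext j
    exact congrFun hG0 (Sum.inr ⟨⟨i, hi⟩, j⟩)
  by_cases hi' : i ∈ P.R ∪ P.T3
  · have h1 : (if i ∈ K then 0 else t i) = 0 := congrFun hG0 (Sum.inl ⟨i, hi'⟩)
    rw [if_neg hi] at h1
    rw [ht i hi hi', h1, zero_smul]; rfl
  · rcases hcov i with h | h | h
    · exact hN i h
    · exact absurd h hi'
    · exact absurd h hi

theorem ne_zero_of_isDualNondeg (h : S.IsDualNondeg ε s) (i : Fin p)
    (hi : i ∈ (S.partition ε).R ∪ (S.partition ε).T3) : s i ≠ 0 := by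
  intro h0
  apply h.ne_zero (Sum.inl ⟨i, hi⟩)
  funext r
  simp [dualNondegMat, h0]

/-- A nondegenerate solution whose block positions are described by `P`. -/
structure IsNondegSol (S : ParamSOCO m p d) (P : ConePartition p) (ε : ℝ) (x : BlockVec d)
    (y : Fin m → ℝ) (s : BlockVec d) : Prop where
  isSol : S.IsSol ε x y s
  pattern : HasPattern P x s
  primalKer : S.PrimalKer P x
  dualKer : S.DualKer P s

namespace IsNondegSol

variable {P : ConePartition p}

theorem primal_unique (h : S.IsNondegSol P ε x y s) : ∀ x' ∈ S.primalOpt ε, x' = x := by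
  intro x' hx'
  refine primalOpt_unique h.dualKer h.isSol.mem_dualOpt
    (fun i hi => ⟨_, h.isSol.mem_dualOpt, (h.pattern.N i).1 hi⟩) (fun i hi => ?_)
    h.isSol.mem_primalOpt hx'
  rcases Finset.mem_union.1 hi with hi | hi
  · exact ((h.pattern.R i).1 hi).2.ne_zero
  · exact ((h.pattern.T3 i).1 hi).2.ne_zero

theorem dual_unique (h : S.IsNondegSol P ε x y s) : ∀ q ∈ S.dualOpt ε, q = (y, s) := by
  intro q hq
  refine dualOpt_unique h.primalKer h.isSol.mem_primalOpt
    (fun i hi => ⟨_, h.isSol.mem_primalOpt, (h.pattern.B i).1 hi⟩) (fun i hi => ?_)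
    h.isSol.mem_dualOpt hq
  rcases Finset.mem_union.1 hi with hi | hi
  · exact ((h.pattern.R i).1 hi).1.ne_zero
  · exact ((h.pattern.T2 i).1 hi).2.ne_zero

theorem partition_eq (h : S.IsNondegSol P ε x y s) : S.partition ε = P :=
  partition_eq_of_unique h.pattern h.isSol.mem_primalOpt h.isSol.mem_dualOpt h.primal_unique
    h.dual_unique

theorem eq_of_isSol (h : S.IsNondegSol P ε x y s) {x' : BlockVec d} {y' : Fin m → ℝ}
    {s' : BlockVec d} (h' : S.IsSol ε x' y' s') : x' = x ∧ y' = y ∧ s' = s :=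
  ⟨h.primal_unique x' h'.mem_primalOpt, by
    have := h.dual_unique _ h'.mem_dualOpt
    simpa using this⟩

end IsNondegSol

/-- The order matters. Dual nondegeneracy gives a unique primal optimum, so the witnesses in the
definitions of R and T2 are x itself and its blocks there lie on the boundary. Only then can primal
nondegeneracy be turned into `PrimalKer`. -/
theorem NondegenerateAt.exists_isNondegSol (h : S.NondegenerateAt ε) :
    ∃ x y s, S.IsNondegSol (S.partition ε) ε x y s := by
  classical
  obtain ⟨x, y, s, ⟨hx, hq⟩, hpn, hdn⟩ := h
  replace hx := intrinsicInterior_subset hx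
  replace hq := intrinsicInterior_subset hq
  have hs := ne_zero_of_isDualNondeg hdn
  have hD := dualKer_of_isDualNondeg hdn partition_cover hs
  have ux : ∀ x' ∈ S.primalOpt ε, x' = x := fun x' hx' =>
    primalOpt_unique hD hq (fun i hi => (Finset.mem_filter.1 hi).2) hs hx hx'
  have hbd : ∀ i ∈ (S.partition ε).R ∪ (S.partition ε).T2, SocBdry (x i) := by
    intro i hi
    rcases Finset.mem_union.1 hi with hi | hi
    · obtain ⟨x', hx', _, _, h, _⟩ := (Finset.mem_filter.1 hi).2
      rw [← ux x' hx']; exact h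
    · obtain ⟨_, x', hx', h⟩ := (Finset.mem_filter.1 hi).2
      rw [← ux x' hx']; exact h
  have hP := primalKer_of_isPrimalNondeg hpn hbd
  have uq : ∀ q ∈ S.dualOpt ε, q = (y, s) := fun q hq' =>
    dualOpt_unique hP hx (fun i hi => (Finset.mem_filter.1 hi).2) (fun i hi => (hbd i hi).ne_zero)
      hq hq'
  exact ⟨x, y, s, isSol_of_mem_opt hx hq, hasPattern_partition hx hq ux uq, hP, hD⟩

end ParamSOCO

/-! ### Stability: openness of the kernel conditions and continuity of unique solutions -/

/-- A closed family of cones that is trivial at one parameter is trivial at nearby parameters. -/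
theorem eventually_trivial_of_isClosed {X E : Type*} [TopologicalSpace X] [NormedAddCommGroup E]
    [NormedSpace ℝ E] [FiniteDimensional ℝ E] {C : X → E → Prop}
    (hcl : IsClosed {z : X × E | C z.1 z.2}) (hsm : ∀ x h (t : ℝ), C x h → C x (t • h)) {x₀ : X}
    (h0 : ∀ h, C x₀ h → h = 0) : ∀ᶠ x in 𝓝 x₀, ∀ h, C x h → h = 0 := by
  have : ProperSpace E := FiniteDimensional.proper ℝ E
  -- By homogeneity it suffices to exclude unit vectors, and these form a compact set.
  have h1 : ∀ᶠ x in 𝓝 x₀, ∀ h ∈ Metric.sphere (0 : E) 1, ¬ C x h := by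
    apply (isCompact_sphere (0 : E) 1).eventually_forall_of_forall_eventually
    intro h hh
    have h2 : (x₀, h) ∈ {z : X × E | C z.1 z.2}ᶜ := by
      intro h3
      rw [h0 h h3] at hh
      simp at hh
    exact hcl.isOpen_compl.mem_nhds h2
  filter_upwards [h1] with x hx h hC
  by_contra hne
  refine hx (‖h‖⁻¹ • h) ?_ (hsm x h _ hC)
  rw [mem_sphere_zero_iff_norm, norm_smul, norm_inv, norm_norm,
    inv_mul_cancel₀ (norm_ne_zero_iff.2 hne)]

/-- Closedness is the reason for expressing proportionality by minors: the condition that f z be a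
multiple of g z need not be closed where g vanishes. -/
theorem isClosed_setOf_para {X ι : Type*} [TopologicalSpace X] {f g : X → ι → ℝ}
    (hf : Continuous f) (hg : Continuous g) : IsClosed {z | Para (f z) (g z)} := by
  simp only [Para, ofPred_forall]
  refine isClosed_iInter fun j => isClosed_iInter fun l => isClosed_eq ?_ ?_ <;> fun_prop

namespace ParamSOCO

variable {m p : ℕ} {d : Fin p → ℕ} {S : ParamSOCO m p d}

theorem PrimalKer.eventually {P : ConePartition p} {x : BlockVec d} (h : S.PrimalKer P x) :
    ∀ᶠ x' in 𝓝 x, S.PrimalKer P x' := by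
  have := eventually_trivial_of_isClosed (x₀ := x)
    (C := fun (x : BlockVec d) (h : Fin m → ℝ) => (∀ i ∈ P.B, (S.A i)ᵀ *ᵥ h = 0) ∧
      ∀ i ∈ P.R ∪ P.T2, Para ((S.A i)ᵀ *ᵥ h) (reflMat (d i) *ᵥ x i)) ?_ ?_
    (fun g hg => h g hg.1 hg.2)
  · filter_upwards [this] with x' hx' g h1 h2 using hx' g ⟨h1, h2⟩
  · simp only [ofPred_and, ofPred_forall]
    refine IsClosed.inter ?_ ?_
    · refine isClosed_iInter fun i => isClosed_iInter fun _ => isClosed_eq ?_ continuous_const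
      exact Continuous.matrix_mulVec continuous_const continuous_snd
    · refine isClosed_iInter fun i => isClosed_iInter fun _ => isClosed_setOf_para ?_ ?_
      · exact Continuous.matrix_mulVec continuous_const continuous_snd
      · exact Continuous.matrix_mulVec continuous_const ((continuous_apply i).comp continuous_fst)
  · rintro x g t ⟨h1, h2⟩
    refine ⟨fun i hi => ?_, fun i hi => ?_⟩
    · rw [Matrix.mulVec_smul, h1 i hi, smul_zero]
    · rw [Matrix.mulVec_smul]
      exact (h2 i hi).smul t

theorem DualKer.eventually {P : ConePartition p} {s : BlockVec d} (h : S.DualKer P s) :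
    ∀ᶠ s' in 𝓝 s, S.DualKer P s' := by
  have := eventually_trivial_of_isClosed (x₀ := s)
    (C := fun (s : BlockVec d) (h : BlockVec d) => ∑ i, S.A i *ᵥ h i = 0 ∧ (∀ i ∈ P.N, h i = 0) ∧
      ∀ i ∈ P.R ∪ P.T3, Para (h i) (reflMat (d i) *ᵥ s i)) ?_ ?_
    (fun g hg => h g hg.1 hg.2.1 hg.2.2)
  · filter_upwards [this] with x' hx' g h1 h2 h3 using hx' g ⟨h1, h2, h3⟩
  · simp only [ofPred_and, ofPred_forall]
    refine IsClosed.inter ?_ (IsClosed.inter ?_ ?_)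
    · refine isClosed_eq (continuous_finsetSum _ fun i _ => ?_) continuous_const
      exact Continuous.matrix_mulVec continuous_const ((continuous_apply i).comp continuous_snd)
    · refine isClosed_iInter fun i => isClosed_iInter fun _ => isClosed_eq ?_ continuous_const
      exact (continuous_apply i).comp continuous_snd
    · refine isClosed_iInter fun i => isClosed_iInter fun _ => isClosed_setOf_para ?_ ?_
      · exact (continuous_apply i).comp continuous_snd
      · exact Continuous.matrix_mulVec continuous_const ((continuous_apply i).comp continuous_fst)
  · rintro x g t ⟨h1, h2, h3⟩
    refine ⟨?_, fun i hi => ?_, fun i hi => ?_⟩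
    · simp only [Pi.smul_apply, Matrix.mulVec_smul, ← Finset.smul_sum, h1, smul_zero]
    · rw [Pi.smul_apply, h2 i hi, smul_zero]
    · exact (h3 i hi).smul t

theorem primalObj_eq_add (ε : ℝ) (x : BlockVec d) :
    S.primalObj ε x = ∑ i, S.c i ⬝ᵥ x i + ε * ∑ i, S.cbar i ⬝ᵥ x i := by
  simp only [primalObj, cost, add_dotProduct, smul_dotProduct, Finset.sum_add_distrib,
    smul_eq_mul, Finset.mul_sum]

theorem cost_convex_comb (ε₀ ε t : ℝ) (i : Fin p) :
    S.cost (ε₀ + t * (ε - ε₀)) i = S.cost ε₀ i + t • (S.cost ε i - S.cost ε₀ i) := by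
  funext j
  simp only [cost, Pi.add_apply, Pi.smul_apply, Pi.sub_apply, smul_eq_mul]
  ring

theorem continuous_cost (i : Fin p) : Continuous fun ε => S.cost ε i := by
  unfold cost
  fun_prop

theorem isClosed_primalFeasible : IsClosed S.primalFeasible := by
  simp only [primalFeasible, ofPred_and, ofPred_forall]
  refine IsClosed.inter ?_ (isClosed_iInter fun i => isClosed_soc.preimage (continuous_apply i))
  refine isClosed_eq (continuous_finsetSum _ fun i _ => ?_) continuous_const
  exact Continuous.matrix_mulVec continuous_const (continuous_apply i)

theorem isClosed_dualFeasible :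
    IsClosed {e : ℝ × ((Fin m → ℝ) × BlockVec d) | e.2 ∈ S.dualFeasible e.1} := by
  have h : {e : ℝ × ((Fin m → ℝ) × BlockVec d) | e.2 ∈ S.dualFeasible e.1} =
      {e | ∀ i, (S.A i)ᵀ *ᵥ e.2.1 + e.2.2 i = S.cost e.1 i} ∩ {e | ∀ i, e.2.2 i ∈ soc (d i)} := rfl
  rw [h, ofPred_forall, ofPred_forall]
  have hs : ∀ i, Continuous fun e : ℝ × ((Fin m → ℝ) × BlockVec d) => e.2.2 i :=
    fun i => by fun_prop
  refine IsClosed.inter ?_ (isClosed_iInter fun i => isClosed_soc.preimage (hs i))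
  refine isClosed_iInter fun i => isClosed_eq ?_ ((continuous_cost i).comp continuous_fst)
  exact (Continuous.matrix_mulVec continuous_const (by fun_prop)).add (hs i)

theorem soc_convex_comb {k : ℕ} {a b : Fin (k + 1) → ℝ} (ha : a ∈ soc k) (hb : b ∈ soc k) {t : ℝ}
    (h0 : 0 ≤ t) (h1 : t ≤ 1) : a + t • (b - a) ∈ soc k := by
  have : a + t • (b - a) = (1 - t) • a + t • b := by
    rw [smul_sub, sub_smul, one_smul]
    abel
  rw [this]
  exact soc_add (soc_smul (sub_nonneg.2 h1) ha) (soc_smul h0 hb)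

/-- Points on the segment between two solutions for different parameters are almost optimal. -/
theorem segment_gap_le {ε₀ ε t : ℝ} {x x' s s' : BlockVec d} {y y' : Fin m → ℝ}
    (h : S.IsSol ε₀ x y s) (h' : S.IsSol ε x' y' s') (h0 : 0 ≤ t) (h1 : t ≤ 1) :
    ∑ i, (x + t • (x' - x)) i ⬝ᵥ (s + t • (s' - s)) i ≤
      |(ε - ε₀) * ∑ i, S.cbar i ⬝ᵥ (x - (x + t • (x' - x))) i| := by
  have e1 := sum_dotProduct_eq_gap h.1.1 h'.2.1.1
  have e2 := sum_dotProduct_eq_gap h'.1.1 h.2.1.1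
  have e3 := h.primalObj_eq
  have e4 := h'.primalObj_eq
  rw [primalObj_eq_add] at e1 e2 e3 e4
  have e5 : ∑ i, (x + t • (x' - x)) i ⬝ᵥ (s + t • (s' - s)) i =
      (1 - t) ^ 2 * ∑ i, x i ⬝ᵥ s i + t * (1 - t) * ∑ i, x i ⬝ᵥ s' i +
        t * (1 - t) * ∑ i, x' i ⬝ᵥ s i + t ^ 2 * ∑ i, x' i ⬝ᵥ s' i := by
    simp only [Finset.mul_sum, ← Finset.sum_add_distrib]
    refine Finset.sum_congr rfl fun i _ => ?_
    simp only [Pi.add_apply, Pi.smul_apply, Pi.sub_apply, add_dotProduct, dotProduct_add,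
      smul_dotProduct, dotProduct_smul, sub_dotProduct, dotProduct_sub, smul_eq_mul]
    ring
  have e6 : ∑ i, S.cbar i ⬝ᵥ (x - (x + t • (x' - x))) i =
      t * (∑ i, S.cbar i ⬝ᵥ x i - ∑ i, S.cbar i ⬝ᵥ x' i) := by
    rw [← Finset.sum_sub_distrib, Finset.mul_sum]
    refine Finset.sum_congr rfl fun i _ => ?_
    simp only [Pi.add_apply, Pi.smul_apply, Pi.sub_apply, dotProduct_add, dotProduct_smul,
      dotProduct_sub, smul_eq_mul]
    ring
  -- The mixed products are duality gaps of x against (y', s') and of x' against (y, s), which gives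
  -- an exact formula for the gap on the segment.
  have e7 : ∑ i, (x + t • (x' - x)) i ⬝ᵥ (s + t • (s' - s)) i =
      (1 - t) * ((ε - ε₀) * ∑ i, S.cbar i ⬝ᵥ (x - (x + t • (x' - x))) i) := by
    rw [e5, e6, h.2.2, h'.2.2, e1, e2, ← e3, ← e4]
    ring
  rw [e7]
  calc _ ≤ |(1 - t) * ((ε - ε₀) * ∑ i, S.cbar i ⬝ᵥ (x - (x + t • (x' - x))) i)| := le_abs_self _
    _ = (1 - t) * |(ε - ε₀) * ∑ i, S.cbar i ⬝ᵥ (x - (x + t • (x' - x))) i| := by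
      rw [abs_mul, abs_of_nonneg (sub_nonneg.2 h1)]
    _ ≤ 1 * _ := mul_le_mul_of_nonneg_right (by linarith) (abs_nonneg _)
    _ = _ := one_mul _

/-- If the solution at `ε₀` is unique, then solutions at nearby parameters are close to it. -/
theorem IsSol.eventually_mem {ε₀ : ℝ} {x s : BlockVec d} {y : Fin m → ℝ} (h : S.IsSol ε₀ x y s)
    (hu : ∀ x' y' s', S.IsSol ε₀ x' y' s' → x' = x ∧ y' = y ∧ s' = s)
    {U : Set (BlockVec d × (Fin m → ℝ) × BlockVec d)} (hU : U ∈ 𝓝 (x, y, s)) :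
    ∀ᶠ ε in 𝓝 ε₀, ∀ x' y' s', S.IsSol ε x' y' s' → (x', y', s') ∈ U := by
  obtain ⟨δ, hδ, hball⟩ := Metric.mem_nhds_iff.1 hU
  set q₀ : BlockVec d × (Fin m → ℝ) × BlockVec d := (x, y, s) with hq₀
  -- The bound on the gap involves only the intermediate point q and not the far endpoint, so it
  -- stays meaningful on a compact sphere although nothing bounds the solutions at ε beforehand. At
  -- (ε₀, 0) the relation C says that q solves the problem at ε₀.
  let C : ℝ × ℝ → BlockVec d × (Fin m → ℝ) × BlockVec d → Prop := fun e q =>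
    q.1 ∈ S.primalFeasible ∧ q.2 ∈ S.dualFeasible e.1 ∧
      ∑ i, q.1 i ⬝ᵥ q.2.2 i ≤ |e.2 * ∑ i, S.cbar i ⬝ᵥ (x - q.1) i|
  have hC : IsClosed {z : (ℝ × ℝ) × (BlockVec d × (Fin m → ℝ) × BlockVec d) | C z.1 z.2} := by
    simp only [C, ofPred_and]
    have hx : ∀ i, Continuous fun z : (ℝ × ℝ) × (BlockVec d × (Fin m → ℝ) × BlockVec d) =>
      z.2.1 i := fun i => by fun_prop
    have hs : ∀ i, Continuous fun z : (ℝ × ℝ) × (BlockVec d × (Fin m → ℝ) × BlockVec d) =>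
      z.2.2.2 i := fun i => by fun_prop
    refine IsClosed.inter ?_ (IsClosed.inter ?_ ?_)
    · exact isClosed_primalFeasible.preimage (by fun_prop :
        Continuous fun z : (ℝ × ℝ) × (BlockVec d × (Fin m → ℝ) × BlockVec d) => z.2.1)
    · exact isClosed_dualFeasible.preimage (by fun_prop :
        Continuous fun z : (ℝ × ℝ) × (BlockVec d × (Fin m → ℝ) × BlockVec d) => (z.1.1, z.2.2))
    · refine isClosed_le (continuous_finsetSum _ fun i _ => (hx i).dotProduct (hs i)) ?_
      refine (Continuous.mul (by fun_prop) (continuous_finsetSum _ fun i _ => ?_)).abs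
      exact continuous_const.dotProduct (continuous_const.sub (hx i))
  have h1 : ∀ᶠ e in 𝓝 ((ε₀, 0) : ℝ × ℝ), ∀ q ∈ Metric.sphere q₀ δ, ¬ C e q := by
    apply (isCompact_sphere q₀ δ).eventually_forall_of_forall_eventually
    rintro ⟨x', y', s'⟩ hq
    have h2 : (((ε₀, 0) : ℝ × ℝ), (x', y', s')) ∈ {z : (ℝ × ℝ) ×
        (BlockVec d × (Fin m → ℝ) × BlockVec d) | C z.1 z.2}ᶜ := by
      rintro ⟨h3, h4, h5⟩
      simp only [zero_mul, abs_zero] at h5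
      obtain ⟨rfl, rfl, rfl⟩ := hu x' y' s' ⟨h3, h4, le_antisymm h5 (Finset.sum_nonneg fun i _ =>
        soc_dotProduct_nonneg (h3.2 i) (h4.2 i))⟩
      rw [Metric.mem_sphere, dist_self] at hq
      exact hδ.ne hq
    exact hC.isOpen_compl.mem_nhds h2
  obtain ⟨r, hr, hr'⟩ := Metric.eventually_nhds_iff.1 h1
  refine Metric.eventually_nhds_iff.2 ⟨r, hr, fun ε hε x' y' s' h' => ?_⟩
  by_contra hnot
  set q : BlockVec d × (Fin m → ℝ) × BlockVec d := (x', y', s') with hq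
  have hd : δ ≤ dist q q₀ := by
    by_contra! hlt
    exact hnot (hball hlt)
  have hd0 : 0 < dist q q₀ := hδ.trans_le hd
  -- The segment from the base solution to a solution outside the ball meets the sphere of radius δ
  -- at this value of t.
  set t := δ / dist q q₀ with ht
  have ht0 : 0 ≤ t := (div_pos hδ hd0).le
  have ht1 : t ≤ 1 := (div_le_one hd0).2 hd
  have hdε : dist (ε₀ + t * (ε - ε₀)) ε₀ < r := by
    rw [Real.dist_eq, add_sub_cancel_left, abs_mul, abs_of_nonneg ht0, ← Real.dist_eq]
    exact (mul_le_of_le_one_left dist_nonneg ht1).trans_lt hε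
  have hde : dist (ε - ε₀) 0 < r := by
    rwa [Real.dist_eq, sub_zero, ← Real.dist_eq]
  -- The first parameter is the one for which the intermediate point is dual feasible; the second is
  -- the whole displacement, which enters the gap bound.
  refine hr' (y := (ε₀ + t * (ε - ε₀), ε - ε₀)) ?_ (q₀ + t • (q - q₀)) ?_ ⟨?_, ?_, ?_⟩
  · exact max_lt hdε hde
  · rw [Metric.mem_sphere, dist_eq_norm, add_sub_cancel_left, norm_smul, Real.norm_eq_abs,
      abs_of_nonneg ht0, ← dist_eq_norm, ht, div_mul_cancel₀ _ hd0.ne']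
  · refine ⟨?_, fun i => soc_convex_comb (h.1.2 i) (h'.1.2 i) ht0 ht1⟩
    change ∑ i, S.A i *ᵥ (x i + t • (x' i - x i)) = S.b
    simp only [Matrix.mulVec_add, Matrix.mulVec_smul, Matrix.mulVec_sub, Finset.sum_add_distrib,
      ← Finset.smul_sum, Finset.sum_sub_distrib]
    rw [h.1.1, h'.1.1, sub_self, smul_zero, add_zero]
  · refine ⟨fun i => ?_, fun i => soc_convex_comb (h.2.1.2 i) (h'.2.1.2 i) ht0 ht1⟩
    change (S.A i)ᵀ *ᵥ (y + t • (y' - y)) + (s i + t • (s' i - s i)) =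
      S.cost (ε₀ + t * (ε - ε₀)) i
    have e1 : (S.A i)ᵀ *ᵥ y + s i = S.cost ε₀ i := h.2.1.1 i
    have e2 : (S.A i)ᵀ *ᵥ y' + s' i = S.cost ε i := h'.2.1.1 i
    rw [cost_convex_comb, ← e1, ← e2, Matrix.mulVec_add, Matrix.mulVec_smul, Matrix.mulVec_sub]
    module
  · exact segment_gap_le h h' ht0 ht1

end ParamSOCO

/-! ### The first-order system and the point attached to an optimal solution -/

namespace ParamSOCO

variable {m p : ℕ} {d : Fin p → ℕ} {S : ParamSOCO m p d} {P : ConePartition p}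

/-- The slack variables, extended by zero to all cones. -/
def slackExt (z : SlackVec d P) : BlockVec d := fun i => if h : i ∈ P.slackIdx then z ⟨i, h⟩ else 0

theorem slackExt_of_mem (z : SlackVec d P) {i : Fin p} (h : i ∈ P.slackIdx) :
    slackExt z i = z ⟨i, h⟩ := dif_pos h

theorem slackExt_of_notMem (z : SlackVec d P) {i : Fin p} (h : i ∉ P.slackIdx) :
    slackExt z i = 0 := dif_neg h

theorem slackExt_restrict {s : BlockVec d} (h : ∀ i ∉ P.slackIdx, s i = 0) :
    slackExt (P := P) (fun i => s i) = s := by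
  funext i
  by_cases hi : i ∈ P.slackIdx
  · rw [slackExt_of_mem _ hi]
  · rw [slackExt_of_notMem _ hi, h i hi]

/-- The multipliers, extended by zero to all cones. -/
def multExt (v : {i // i ∈ P.quadIdx} → ℝ) : Fin p → ℝ :=
  fun i => if h : i ∈ P.quadIdx then v ⟨i, h⟩ else 0

theorem multExt_of_mem (v : {i // i ∈ P.quadIdx} → ℝ) {i : Fin p} (h : i ∈ P.quadIdx) :
    multExt v i = v ⟨i, h⟩ := dif_pos h

/-- Extension by zero merges the two families of affine constraints into one dual constraint and
removes the subtype indices. The signs make -u the primal candidate. -/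
theorem kktMap_eq_zero_iff {q : KKTVar m d P} {ε : ℝ} : S.kktMap P q ε = 0 ↔
    ∑ i, S.A i *ᵥ (-q.u) i = S.b ∧
    (∀ i ∈ P.quadIdx, q.u i = -((2 * multExt q.v i) • (reflMat (d i) *ᵥ slackExt q.z i))) ∧
    (∀ i ∈ P.slackIdx, i ∉ P.quadIdx → q.u i = 0) ∧
    (∀ i, (S.A i)ᵀ *ᵥ q.w + slackExt q.z i = S.cost ε i) ∧
    (∀ i ∈ P.quadIdx, slackExt q.z i ⬝ᵥ (reflMat (d i) *ᵥ slackExt q.z i) = 0) := by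
  rw [kktMap, Prod.ext_iff, Prod.ext_iff, Prod.ext_iff]
  have e1 : ∑ i, S.A i *ᵥ (-q.u) i = -∑ i, S.A i *ᵥ q.u i := by
    simp only [Pi.neg_apply, Matrix.mulVec_neg, Finset.sum_neg_distrib]
  simp only [Prod.fst_zero, Prod.snd_zero, e1, sub_eq_zero]
  refine and_congr Iff.rfl ?_
  constructor
  · rintro ⟨h1, h2, h3⟩
    refine ⟨fun i hi => ?_, fun i hi hi' => ?_, fun i => ?_, fun i hi => ?_⟩
    · have hs := ConePartition.mem_slackIdx_of_mem_quadIdx hi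
      have := congrFun h1 ⟨i, hs⟩
      simp only [hi, dif_pos, Pi.zero_apply] at this
      rw [multExt_of_mem _ hi, slackExt_of_mem _ hs, ← sub_eq_zero.1 this, neg_neg]
    · have := congrFun h1 ⟨i, hi⟩
      simp only [hi', dif_neg, Pi.zero_apply, not_false_eq_true] at this
      exact neg_eq_zero.1 this
    · have := congrFun h2 i
      by_cases hi : i ∈ P.slackIdx
      · simp only [hi, dif_pos, Pi.zero_apply] at this
        rw [slackExt_of_mem _ hi]
        exact sub_eq_zero.1 this
      · simp only [hi, dif_neg, Pi.zero_apply, not_false_eq_true] at this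
        rw [slackExt_of_notMem _ hi, add_zero]
        exact sub_eq_zero.1 this
    · rw [slackExt_of_mem _ (ConePartition.mem_slackIdx_of_mem_quadIdx hi)]
      exact congrFun h3 ⟨i, hi⟩
  · rintro ⟨h1, h2, h3, h4⟩
    refine ⟨funext fun i => ?_, funext fun i => ?_, funext fun i => ?_⟩
    · by_cases hi : i.1 ∈ P.quadIdx
      · have := h1 i.1 hi
        rw [multExt_of_mem _ hi, slackExt_of_mem _ i.2] at this
        simp only [hi, dif_pos, Pi.zero_apply]
        rw [this, neg_neg, sub_self]
      · simp only [hi, dif_neg, Pi.zero_apply, not_false_eq_true]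
        rw [h2 i.1 i.2 hi, neg_zero]
    · have := h3 i
      by_cases hi : i ∈ P.slackIdx
      · simp only [hi, dif_pos, Pi.zero_apply]
        rw [slackExt_of_mem _ hi] at this
        exact sub_eq_zero.2 this
      · simp only [hi, dif_neg, Pi.zero_apply, not_false_eq_true]
        rw [slackExt_of_notMem _ hi, add_zero] at this
        exact sub_eq_zero.2 this
    · have := h4 i.1 i.2
      rwa [slackExt_of_mem _ (ConePartition.mem_slackIdx_of_mem_quadIdx i.2)] at this

/-- The solution of the first-order system that belongs to a complementary pair. -/
noncomputable def kktPoint (P : ConePartition p) (x : BlockVec d) (y : Fin m → ℝ)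
    (s : BlockVec d) : KKTVar m d P :=
  (y, fun i => s i, -x, fun i => x i 0 / (2 * s i 0))

/-- Only the zero and boundary positions are assumed, not nondegeneracy, so that the result also
applies to solutions at nearby parameters. -/
theorem IsSol.kktMap_kktPoint {ε : ℝ} {x s : BlockVec d} {y : Fin m → ℝ} (h : S.IsSol ε x y s)
    (h1 : ∀ i ∉ P.slackIdx, s i = 0) (h2 : ∀ i ∈ P.slackIdx, i ∉ P.quadIdx → x i = 0)
    (h3 : ∀ i ∈ P.quadIdx, SocBdry (s i)) : S.kktMap P (kktPoint P x y s) ε = 0 := by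
  rw [kktMap_eq_zero_iff]
  have hz : slackExt (kktPoint P x y s : KKTVar m d P).z = s := slackExt_restrict h1
  rw [hz]
  refine ⟨?_, fun i hi => ?_, fun i hi hi' => ?_, h.2.1.1, fun i hi => ?_⟩
  · change ∑ i, S.A i *ᵥ (- -x) i = S.b
    rw [neg_neg]
    exact h.1.1
  · rw [multExt_of_mem _ hi]
    change -x i = -((2 * (x i 0 / (2 * s i 0))) • _)
    -- The equation u = -2v R z with u = -x reads x = 2v R s, and complementarity forces the factor
    -- x_1 / s_1; this fixes the denominator 2 s_1 in `kktPoint`.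
    rw [show 2 * (x i 0 / (2 * s i 0)) = x i 0 / s i 0 by field_simp,
      ← eq_smul_reflMat_of_dotProduct_eq_zero (h.1.2 i) (h3 i hi) (h.dotProduct_eq_zero i)]
  · change -x i = 0
    rw [h2 i hi hi', neg_zero]
  · exact (h3 i hi).dotProduct_reflMat_self

namespace IsNondegSol

variable {ε : ℝ} {x s : BlockVec d} {y : Fin m → ℝ}

theorem slack_eq_zero_of_mem (h : S.IsNondegSol P ε x y s) {i : Fin p}
    (hi : i ∈ P.B ∪ P.T1 ∪ P.T2) : s i = 0 := by
  simp only [Finset.mem_union] at hi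
  rcases hi with (hi | hi) | hi
  · exact eq_zero_of_socInt_dotProduct ((h.pattern.B i).1 hi) (h.isSol.2.1.2 i)
      (h.isSol.dotProduct_eq_zero i)
  · exact ((h.pattern.T1 i).1 hi).2
  · exact ((h.pattern.T2 i).1 hi).1

theorem mem_of_notMem_slackIdx (h : S.IsNondegSol P ε x y s) {i : Fin p} (hi : i ∉ P.slackIdx) :
    i ∈ P.B ∪ P.T1 ∪ P.T2 := by
  simp only [ConePartition.slackIdx, Finset.mem_union, not_or, h.pattern.R, h.pattern.N,
    h.pattern.T3] at hi
  simp only [Finset.mem_union, h.pattern.B, h.pattern.T1, h.pattern.T2]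
  have h1 := soc_trichotomy (h.isSol.1.2 i)
  have h2 := soc_trichotomy (h.isSol.2.1.2 i)
  tauto

theorem slack_eq_zero_of_notMem (h : S.IsNondegSol P ε x y s) {i : Fin p}
    (hi : i ∉ P.slackIdx) : s i = 0 := h.slack_eq_zero_of_mem (h.mem_of_notMem_slackIdx hi)

theorem slack_ne_zero (h : S.IsNondegSol P ε x y s) {i : Fin p} (hi : i ∈ P.slackIdx) :
    s i ≠ 0 := by
  simp only [ConePartition.slackIdx, Finset.mem_union] at hi
  rcases hi with (hi | hi) | hi
  · exact ((h.pattern.R i).1 hi).2.ne_zero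
  · intro h0
    have := (h.pattern.N i).1 hi
    rw [h0] at this
    simp at this
  · exact ((h.pattern.T3 i).1 hi).2.ne_zero

theorem socBdry_of_mem_quadIdx (h : S.IsNondegSol P ε x y s) {i : Fin p} (hi : i ∈ P.quadIdx) :
    SocBdry (s i) := by
  rcases Finset.mem_union.1 hi with hi | hi
  · exact ((h.pattern.R i).1 hi).2
  · exact ((h.pattern.T3 i).1 hi).2

theorem mem_N_iff (h : S.IsNondegSol P ε x y s) {i : Fin p} :
    i ∈ P.N ↔ i ∈ P.slackIdx ∧ i ∉ P.quadIdx := by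
  constructor
  · intro hi
    refine ⟨by simp [ConePartition.slackIdx, hi], fun hq => ?_⟩
    exact (h.socBdry_of_mem_quadIdx hq).not_int ((h.pattern.N i).1 hi)
  · rintro ⟨h1, h2⟩
    simp only [ConePartition.slackIdx, ConePartition.quadIdx, Finset.mem_union] at h1 h2
    tauto

theorem primal_eq_zero_of_mem_N (h : S.IsNondegSol P ε x y s) {i : Fin p} (hi : i ∈ P.N) :
    x i = 0 :=
  eq_zero_of_socInt_dotProduct ((h.pattern.N i).1 hi) (h.isSol.1.2 i)
    (by rw [dotProduct_comm]; exact h.isSol.dotProduct_eq_zero i)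

theorem kktMap_kktPoint (h : S.IsNondegSol P ε x y s) :
    S.kktMap P (kktPoint P x y s) ε = 0 :=
  h.isSol.kktMap_kktPoint (fun _ hi => h.slack_eq_zero_of_notMem hi)
    (fun _ hi hi' => h.primal_eq_zero_of_mem_N (h.mem_N_iff.2 ⟨hi, hi'⟩))
    (fun _ hi => h.socBdry_of_mem_quadIdx hi)

/-- The quadratic equation together with a positive first coordinate describes nonzero boundary
points of the cone. The reformulation thus restricts the dual problem, and weak duality bounds it.
-/
theorem dualFeasible_of_dnFeasible (h : S.IsNondegSol P ε x y s)
    {q : (Fin m → ℝ) × SlackVec d P} (hq : q ∈ S.dnFeasible P ε) :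
    (q.1, slackExt q.2) ∈ S.dualFeasible ε := by
  obtain ⟨h1, h2, h3, h4⟩ := hq
  refine ⟨fun i => ?_, fun i => ?_⟩
  · by_cases hi : i ∈ P.slackIdx
    · exact (congrArg _ (slackExt_of_mem _ hi)).trans (h2 ⟨i, hi⟩)
    · exact ((congrArg _ (slackExt_of_notMem _ hi)).trans (add_zero _)).trans
        (h1 i (h.mem_of_notMem_slackIdx hi))
  · change slackExt q.2 i ∈ soc (d i)
    by_cases hi : i ∈ P.slackIdx
    · rw [slackExt_of_mem _ hi]
      by_cases hi' : i ∈ P.quadIdx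
      · have := h3 ⟨i, hi⟩ hi'
        exact (socBdry_of_dotProduct_reflMat_self this.1 this.2).mem_soc
      · exact le_of_lt (show tailNorm _ < _ from h4 ⟨i, hi⟩ (h.mem_N_iff.2 ⟨hi, hi'⟩))
    · rw [slackExt_of_notMem _ hi]
      exact zero_mem_soc

theorem dnFeasible_kktPoint (h : S.IsNondegSol P ε x y s) :
    ((kktPoint P x y s : KKTVar m d P).w, (kktPoint P x y s : KKTVar m d P).z) ∈
      S.dnFeasible P ε := by
  refine ⟨fun i hi => ?_, fun i => h.isSol.2.1.1 i, fun i hi => ?_, fun i hi => ?_⟩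
  · have h1 : (S.A i)ᵀ *ᵥ y + s i = S.cost ε i := h.isSol.2.1.1 i
    rwa [h.slack_eq_zero_of_mem hi, add_zero] at h1
  · have := h.socBdry_of_mem_quadIdx hi
    exact ⟨this.dotProduct_reflMat_self, this.pos⟩
  · exact (h.pattern.N i.1).1 hi

theorem isDNGlobalOpt_kktPoint (h : S.IsNondegSol P ε x y s) :
    S.IsDNGlobalOpt P ε (kktPoint P x y s : KKTVar m d P).w
      (kktPoint P x y s : KKTVar m d P).z := by
  refine ⟨h.dnFeasible_kktPoint, fun q hq => neg_le_neg ?_⟩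
  rw [show S.b ⬝ᵥ (kktPoint P x y s : KKTVar m d P).w = S.primalObj ε x from
    h.isSol.primalObj_eq.symm]
  exact weak_duality h.isSol.1 (h.dualFeasible_of_dnFeasible hq)

/-- The globally optimal solution of the nonlinear reformulation and its Lagrange multipliers are
unique. -/
theorem eq_kktPoint (h : S.IsNondegSol P ε x y s) {q : KKTVar m d P}
    (hq : S.kktMap P q ε = 0) (hopt : S.IsDNGlobalOpt P ε q.w q.z) : q = kktPoint P x y s := by
  have hf := h.dualFeasible_of_dnFeasible hopt.1
  have h1 : (q.w, slackExt q.z) ∈ S.dualOpt ε := by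
    refine ⟨le_antisymm (le_optVal hf) ?_, hf⟩
    rw [← h.isSol.mem_dualOpt.1]
    exact EReal.coe_le_coe_iff.2 (neg_le_neg_iff.1 (hopt.2 _ h.dnFeasible_kktPoint))
  have h2 := h.dual_unique _ h1
  have hw : q.w = y := congrArg Prod.fst h2
  have hz : slackExt q.z = s := congrArg Prod.snd h2
  obtain ⟨k1, k2, k3, -, -⟩ := kktMap_eq_zero_iff.1 hq
  rw [hz] at k2
  -- `DualKer` needs only linear information, so -u may be compared with x before it is known to lie
  -- in the cone.
  have hu : -q.u - x = 0 := by
    apply h.dualKer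
    · simp only [Pi.sub_apply, Matrix.mulVec_sub, Finset.sum_sub_distrib]
      rw [k1, h.isSol.1.1, sub_self]
    · intro i hi
      have h3 := h.mem_N_iff.1 hi
      rw [Pi.sub_apply, Pi.neg_apply, k3 i h3.1 h3.2, h.primal_eq_zero_of_mem_N hi, neg_zero,
        sub_zero]
    · intro i hi
      rw [Pi.sub_apply, Pi.neg_apply, k2 i hi, neg_neg,
        eq_smul_reflMat_of_dotProduct_eq_zero (h.isSol.1.2 i) (h.socBdry_of_mem_quadIdx hi)
          (h.isSol.dotProduct_eq_zero i), ← sub_smul]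
      exact para_smul_self _ _
  have hu' : q.u = -x := by rw [← sub_eq_zero.1 hu, neg_neg]
  refine Prod.ext hw (Prod.ext ?_ (Prod.ext hu' ?_))
  · funext i
    have := congrFun hz i.1
    rwa [slackExt_of_mem _ i.2] at this
  · funext i
    have h3 := congrFun (k2 i.1 i.2) 0
    rw [multExt_of_mem _ i.2, hu'] at h3
    simp only [Pi.neg_apply, Pi.smul_apply, reflMat_mulVec, reflSign_zero, one_mul,
      smul_eq_mul, neg_inj] at h3
    have h4 := (h.socBdry_of_mem_quadIdx i.2).pos
    change q.v i = x i.1 0 / (2 * s i.1 0)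
    rw [h3]
    field_simp

end IsNondegSol

end ParamSOCO

/-! ### Nonsingularity and analyticity of the first-order system -/

namespace ParamSOCO

variable {m p : ℕ} {d : Fin p → ℕ} {S : ParamSOCO m p d} {P : ConePartition p}

variable (S) in
/-- The differential of the first-order system at `q` in the direction `k`, for a fixed parameter. -/
def kktDeriv (q k : KKTVar m d P) : KKTVar m d P :=
  (-(∑ i, S.A i *ᵥ k.u i),
   (fun i => if h : i.1 ∈ P.quadIdx
      then -k.u i - ((2 * k.v ⟨i.1, h⟩) • (reflMat (d i) *ᵥ q.z i) +
        (2 * q.v ⟨i.1, h⟩) • (reflMat (d i) *ᵥ k.z i))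
      else -k.u i),
   (fun i => if h : i ∈ P.slackIdx
      then (S.A i)ᵀ *ᵥ k.w + k.z ⟨i, h⟩
      else (S.A i)ᵀ *ᵥ k.w),
   (fun i => 2 * (q.z ⟨i.1, ConePartition.mem_slackIdx_of_mem_quadIdx i.2⟩ ⬝ᵥ
      (reflMat (d i) *ᵥ k.z ⟨i.1, ConePartition.mem_slackIdx_of_mem_quadIdx i.2⟩))))

/-- The quadratic part of the first-order system. -/
def kktQuad (k : KKTVar m d P) : KKTVar m d P :=
  (0,
   (fun i => if h : i.1 ∈ P.quadIdx then -((2 * k.v ⟨i.1, h⟩) • (reflMat (d i) *ᵥ k.z i)) else 0),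
   0,
   (fun i => k.z ⟨i.1, ConePartition.mem_slackIdx_of_mem_quadIdx i.2⟩ ⬝ᵥ
      (reflMat (d i) *ᵥ k.z ⟨i.1, ConePartition.mem_slackIdx_of_mem_quadIdx i.2⟩)))

/-- G is quadratic in its first argument, so this expansion is exact. It lets the differential be
read off along lines. -/
theorem kktMap_add_smul (q k : KKTVar m d P) (ε t : ℝ) :
    S.kktMap P (q + t • k) ε = S.kktMap P q ε + t • S.kktDeriv q k + t ^ 2 • kktQuad k := by
  refine Prod.ext ?_ (Prod.ext ?_ (Prod.ext ?_ ?_))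
  · simp only [kktMap, kktDeriv, kktQuad, KKTVar.u, Prod.fst_add, Prod.smul_fst, Prod.snd_add,
      Prod.smul_snd, Pi.add_apply, Pi.smul_apply, Matrix.mulVec_add, Matrix.mulVec_smul,
      Finset.sum_add_distrib, ← Finset.smul_sum]
    module
  · funext i
    simp only [kktMap, kktDeriv, kktQuad, KKTVar.u, KKTVar.v, KKTVar.z, Prod.fst_add,
      Prod.smul_fst, Prod.snd_add, Prod.smul_snd, Pi.add_apply, Pi.smul_apply]
    split_ifs
    · simp only [Matrix.mulVec_add, Matrix.mulVec_smul, smul_eq_mul]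
      module
    · module
  · funext i
    simp only [kktMap, kktDeriv, kktQuad, KKTVar.w, KKTVar.z, Prod.fst_add,
      Prod.smul_fst, Prod.snd_add, Prod.smul_snd, Pi.add_apply, Pi.smul_apply, Pi.zero_apply]
    split_ifs
    · simp only [Matrix.mulVec_add, Matrix.mulVec_smul]
      module
    · simp only [Matrix.mulVec_add, Matrix.mulVec_smul]
      module
  · funext i
    simp only [kktMap, kktDeriv, kktQuad, KKTVar.z, Prod.fst_add,
      Prod.smul_fst, Prod.snd_add, Prod.smul_snd, Pi.add_apply, Pi.smul_apply, Matrix.mulVec_add,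
      Matrix.mulVec_smul, dotProduct_add, add_dotProduct, smul_dotProduct, dotProduct_smul,
      smul_eq_mul]
    rw [dotProduct_reflMat_comm (k.2.1 _) (q.2.1 _)]
    ring

theorem kktDeriv_eq_zero {q k : KKTVar m d P} (hk : S.kktDeriv q k = 0) :
    ∑ i, S.A i *ᵥ k.u i = 0 ∧
    (∀ i ∈ P.quadIdx, k.u i = -((2 * multExt k.v i) • (reflMat (d i) *ᵥ slackExt q.z i) +
      (2 * multExt q.v i) • (reflMat (d i) *ᵥ slackExt k.z i))) ∧
    (∀ i ∈ P.slackIdx, i ∉ P.quadIdx → k.u i = 0) ∧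
    (∀ i, (S.A i)ᵀ *ᵥ k.w = -slackExt k.z i) ∧
    (∀ i ∈ P.quadIdx, slackExt q.z i ⬝ᵥ (reflMat (d i) *ᵥ slackExt k.z i) = 0) := by
  rw [kktDeriv, Prod.ext_iff, Prod.ext_iff, Prod.ext_iff] at hk
  obtain ⟨h0, h1, h2, h3⟩ := hk
  refine ⟨neg_eq_zero.1 h0, fun i hi => ?_, fun i hi hi' => ?_, fun i => ?_, fun i hi => ?_⟩
  · have hs := ConePartition.mem_slackIdx_of_mem_quadIdx hi
    have := congrFun h1 ⟨i, hs⟩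
    simp only [hi, dif_pos, Prod.fst_zero, Prod.snd_zero, Pi.zero_apply] at this
    rw [multExt_of_mem _ hi, multExt_of_mem _ hi, slackExt_of_mem _ hs, slackExt_of_mem _ hs,
      ← sub_eq_zero.1 this, neg_neg]
  · have := congrFun h1 ⟨i, hi⟩
    simp only [hi', dif_neg, Prod.fst_zero, Prod.snd_zero, Pi.zero_apply, not_false_eq_true]
      at this
    exact neg_eq_zero.1 this
  · have := congrFun h2 i
    by_cases hi : i ∈ P.slackIdx
    · simp only [hi, dif_pos, Prod.fst_zero, Prod.snd_zero, Pi.zero_apply] at this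
      rw [slackExt_of_mem _ hi]
      exact eq_neg_of_add_eq_zero_left this
    · simp only [hi, dif_neg, Prod.fst_zero, Prod.snd_zero, Pi.zero_apply, not_false_eq_true]
        at this
      rw [slackExt_of_notMem _ hi, neg_zero]
      exact this
  · have hs := ConePartition.mem_slackIdx_of_mem_quadIdx hi
    have : 2 * (q.z ⟨i, hs⟩ ⬝ᵥ (reflMat (d i) *ᵥ k.z ⟨i, hs⟩)) = 0 := congrFun h3 ⟨i, hi⟩
    rw [slackExt_of_mem _ hs, slackExt_of_mem _ hs]
    linarith

namespace IsNondegSol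

variable {ε : ℝ} {x s : BlockVec d} {y : Fin m → ℝ}

theorem notMem_slackIdx (h : S.IsNondegSol P ε x y s) {i : Fin p}
    (hi : i ∈ P.B ∪ P.T1 ∪ P.T2) : i ∉ P.slackIdx :=
  fun hs => h.slack_ne_zero hs (h.slack_eq_zero_of_mem hi)

/-- The first-order system is nonsingular at a nondegenerate solution. -/
theorem eq_zero_of_kktDeriv (h : S.IsNondegSol P ε x y s) {k : KKTVar m d P}
    (hk : S.kktDeriv (kktPoint P x y s) k = 0) : k = 0 := by
  obtain ⟨a1, a2, a3, a4, a5⟩ := kktDeriv_eq_zero hk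
  have hz : slackExt (kktPoint P x y s : KKTVar m d P).z = s :=
    slackExt_restrict fun _ hi => h.slack_eq_zero_of_notMem hi
  have hv : ∀ i ∈ P.quadIdx, 2 * multExt (kktPoint P x y s : KKTVar m d P).v i =
      x i 0 / s i 0 := by
    intro i hi
    rw [multExt_of_mem _ hi]
    change 2 * (x i 0 / (2 * s i 0)) = x i 0 / s i 0
    field_simp
  rw [hz] at a2 a5
  set Z : BlockVec d := slackExt k.z with hZ
  -- The equation ∑ A^i u^i = 0 is paired with w, and (A^i)ᵀw = -Z^i.
  have b1 : ∑ i, k.u i ⬝ᵥ Z i = 0 := by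
    have h1 := sum_dotProduct_transpose_mulVec (S := S) k.u k.w
    simp only [a1, zero_dotProduct, a4, dotProduct_neg, Finset.sum_neg_distrib] at h1
    exact neg_eq_zero.1 h1
  have b2 : ∀ i ∈ P.quadIdx, k.u i ⬝ᵥ Z i =
      -(x i 0 / s i 0 * (Z i ⬝ᵥ (reflMat (d i) *ᵥ Z i))) := by
    intro i hi
    rw [a2 i hi, hv i hi, neg_dotProduct, add_dotProduct, smul_dotProduct, smul_dotProduct,
      dotProduct_comm _ (Z i), dotProduct_reflMat_comm, a5 i hi, dotProduct_comm _ (Z i),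
      smul_zero, zero_add, smul_eq_mul]
  -- Z^i is tangent to the light cone at s^i, so its Lorentz form is nonpositive, while x^i_1 /
  -- s^i_1 ≥ 0.
  have b3 : ∀ i, 0 ≤ k.u i ⬝ᵥ Z i := by
    intro i
    by_cases hi : i ∈ P.quadIdx
    · have hs := h.socBdry_of_mem_quadIdx hi
      rw [b2 i hi, ← mul_neg]
      refine mul_nonneg (div_nonneg ?_ hs.pos.le) (neg_nonneg.2 (tangent_nonpos hs (a5 i hi)))
      exact (tailNorm_nonneg _).trans (h.isSol.1.2 i)
    by_cases hi' : i ∈ P.slackIdx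
    · rw [a3 i hi' hi, zero_dotProduct]
    · rw [hZ, slackExt_of_notMem _ hi', dotProduct_zero]
  have b4 : ∀ i, k.u i ⬝ᵥ Z i = 0 := fun i =>
    (Finset.sum_eq_zero_iff_of_nonneg fun i _ => b3 i).1 b1 i (Finset.mem_univ i)
  have hZ0 : ∀ i ∈ P.B ∪ P.T1 ∪ P.T2, Z i = 0 := fun i hi =>
    slackExt_of_notMem _ (h.notMem_slackIdx hi)
  -- On R the factor x^i_1 / s^i_1 is positive, so Z^i is both tangent and null. It is then parallel
  -- to s^i, hence to R x^i, as `PrimalKer` requires. On B and T2 it is zero.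
  have hw : k.w = 0 := by
    apply h.primalKer
    · intro i hi
      rw [a4, hZ0 i (by simp [hi]), neg_zero]
    · intro i hi
      rcases Finset.mem_union.1 hi with hi | hi
      · obtain ⟨hx, hs⟩ := (h.pattern.R i).1 hi
        have hq : i ∈ P.quadIdx := Finset.mem_union_left _ hi
        have h1 := b4 i
        rw [b2 i hq, neg_eq_zero] at h1
        have h2 := (mul_eq_zero.1 h1).resolve_left (div_pos hx.pos hs.pos).ne'
        have h3 := tangent_eq_smul hs (a5 i hq) h2
        have h4 := h.isSol.dotProduct_eq_zero i
        rw [dotProduct_comm] at h4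
        have h5 : s i = (s i 0 / x i 0) • (reflMat (d i) *ᵥ x i) :=
          eq_smul_reflMat_of_dotProduct_eq_zero (h.isSol.2.1.2 i) hx h4
        have h6 : -Z i = (-(Z i 0 / s i 0 * (s i 0 / x i 0))) • (reflMat (d i) *ᵥ x i) := by
          rw [neg_smul, mul_smul, ← h5, ← h3]
        rw [a4, h6]
        exact para_smul_self _ _
      · rw [a4, hZ0 i (by simp [hi]), neg_zero, ← zero_smul ℝ (reflMat (d i) *ᵥ x i)]
        exact para_smul_self _ _
  have hZ1 : Z = 0 := by
    funext i
    have := a4 i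
    rw [hw, Matrix.mulVec_zero] at this
    exact neg_eq_zero.1 this.symm
  have a2' : ∀ i ∈ P.quadIdx, k.u i = (-(2 * multExt k.v i)) • (reflMat (d i) *ᵥ s i) := by
    intro i hi
    rw [a2 i hi, hZ1, Pi.zero_apply, Matrix.mulVec_zero, smul_zero, add_zero, neg_smul]
  -- Once Z = 0, the blocks of u on R ∪ T3 are multiples of R s^i and `DualKer` applies.
  have hu : k.u = 0 := by
    apply h.dualKer _ a1
    · intro i hi
      have := h.mem_N_iff.1 hi
      exact a3 i this.1 this.2
    · intro i hi
      rw [a2' i hi]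
      exact para_smul_self _ _
  refine Prod.ext hw (Prod.ext ?_ (Prod.ext hu ?_))
  · funext i
    have := congrFun hZ1 i.1
    rwa [hZ, slackExt_of_mem _ i.2] at this
  · funext i
    have h1 := a2' i.1 i.2
    rw [hu, multExt_of_mem _ i.2] at h1
    have h2 := smul_eq_zero.1 h1.symm
    have h3 := h2.resolve_right (reflMat_mulVec_ne_zero (h.socBdry_of_mem_quadIdx i.2).ne_zero)
    change k.v i = 0
    linarith

end IsNondegSol

theorem contDiff_mulVec {E : Type*} [NormedAddCommGroup E] [NormedSpace ℝ E] {k l : ℕ}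
    (M : Matrix (Fin k) (Fin l) ℝ) {f : E → Fin l → ℝ} (hf : ContDiff ℝ ⊤ f) :
    ContDiff ℝ ⊤ fun e => M *ᵥ f e :=
  (LinearMap.toContinuousLinearMap M.mulVecLin).contDiff.comp hf

/-- The exponent `⊤` is the analytic one, so the local inverse built from G is analytic and not
merely smooth. -/
theorem contDiff_kktMap :
    ContDiff ℝ ⊤ fun e : KKTVar m d P × ℝ => S.kktMap P e.1 e.2 := by
  have hw : ContDiff ℝ ⊤ fun e : KKTVar m d P × ℝ => e.1.w := contDiff_fst.fst
  have hz : ∀ i, ContDiff ℝ ⊤ fun e : KKTVar m d P × ℝ => e.1.z i :=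
    contDiff_pi.1 contDiff_fst.snd.fst
  have hu : ∀ i, ContDiff ℝ ⊤ fun e : KKTVar m d P × ℝ => e.1.u i :=
    contDiff_pi.1 contDiff_fst.snd.snd.fst
  have hv : ∀ i, ContDiff ℝ ⊤ fun e : KKTVar m d P × ℝ => e.1.v i :=
    contDiff_pi.1 contDiff_fst.snd.snd.snd
  have hc : ∀ i, ContDiff ℝ ⊤ fun e : KKTVar m d P × ℝ => S.cost e.2 i := fun i =>
    contDiff_const.add (contDiff_snd.smul contDiff_const)
  refine ContDiff.prodMk ?_ (ContDiff.prodMk ?_ (ContDiff.prodMk ?_ ?_))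
  · exact (ContDiff.sum fun i _ => contDiff_mulVec _ (hu i)).neg.sub contDiff_const
  · refine contDiff_pi.2 fun i => ?_
    split_ifs
    · exact (hu _).neg.sub ((contDiff_const.mul (hv _)).smul (contDiff_mulVec _ (hz _)))
    · exact (hu _).neg
  · refine contDiff_pi.2 fun i => ?_
    split_ifs with hi
    · exact ((contDiff_mulVec (S.A i)ᵀ hw).add (hz ⟨i, hi⟩)).sub (hc i)
    · exact (contDiff_mulVec (S.A i)ᵀ hw).sub (hc i)
  · refine contDiff_pi.2 fun i => ?_
    have hi := hz ⟨i.1, ConePartition.mem_slackIdx_of_mem_quadIdx i.2⟩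
    exact ContDiff.sum fun j _ =>
      (contDiff_pi.1 hi j).mul (contDiff_pi.1 (contDiff_mulVec (reflMat (d i)) hi) j)

end ParamSOCO

/-! ### Analytic solution branches and maximal intervals of constancy -/

/-- An analytic function with vanishing derivatives is locally constant. -/
theorem AnalyticAt.eventually_eq_of_iteratedDeriv {f : ℝ → ℝ} {a : ℝ} (hf : AnalyticAt ℝ f a)
    (h : ∀ k : ℕ, 1 ≤ k → iteratedDeriv k f a = 0) : ∀ᶠ t in 𝓝 a, f t = f a := by
  have hg : AnalyticAt ℝ (fun t => f t - f a) a := hf.sub analyticAt_const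
  have h1 : analyticOrderAt (fun t => f t - f a) a = ⊤ := by
    rw [ENat.eq_top_iff_forall_ge]
    intro n
    rw [natCast_le_analyticOrderAt_iff_iteratedDeriv_eq_zero hg]
    intro k _
    rcases k with _ | k
    · simp
    · have h2 : deriv (fun t => f t - f a) = deriv f := by
        funext t
        exact deriv_sub_const (f a)
      rw [iteratedDeriv_succ', h2, ← iteratedDeriv_succ']
      exact h (k + 1) (Nat.le_add_left 1 k)
  filter_upwards [analyticOrderAt_eq_top.1 h1] with t ht
  exact sub_eq_zero.1 ht

theorem iteratedDeriv_eq_zero_of_eventually {f : ℝ → ℝ} {a : ℝ} (h : ∀ᶠ t in 𝓝 a, f t = 0)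
    (k : ℕ) : iteratedDeriv k f a = 0 := by
  have h1 : f =ᶠ[𝓝 a] fun _ => (0 : ℝ) := h
  rw [h1.iteratedDeriv_eq k]
  exact iteratedDeriv_fun_const_zero

namespace ParamSOCO

variable {m p : ℕ} {d : Fin p → ℕ} {S : ParamSOCO m p d} {P : ConePartition p}

namespace IsNondegSol

variable {ε : ℝ} {x s : BlockVec d} {y : Fin m → ℝ}

/-- The implicit function theorem for the first-order system. -/
theorem exists_solution_branch (h : S.IsNondegSol P ε x y s) :
    ∃ χ : ℝ → KKTVar m d P, AnalyticAt ℝ χ ε ∧ χ ε = kktPoint P x y s ∧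
      (∀ᶠ e in 𝓝 ε, S.kktMap P (χ e) e = 0) ∧
      ∀ᶠ z in 𝓝 ((kktPoint P x y s : KKTVar m d P), ε),
        S.kktMap P z.1 z.2 = 0 → z.1 = χ z.2 := by
  set q₀ : KKTVar m d P := kktPoint P x y s with hq₀
  -- Keeping the parameter as an output reduces the implicit function theorem to the inverse
  -- function theorem.
  let Φ : KKTVar m d P × ℝ → KKTVar m d P × ℝ := fun z => (S.kktMap P z.1 z.2, z.2)
  have hΦ : ContDiff ℝ ⊤ Φ := contDiff_kktMap.prodMk contDiff_snd
  have hd : HasFDerivAt Φ (fderiv ℝ Φ (q₀, ε)) (q₀, ε) :=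
    ((hΦ.differentiable (by simp)) _).hasFDerivAt
  have hker : ∀ v, fderiv ℝ Φ (q₀, ε) v = 0 → v = 0 := by
    rintro ⟨k, e⟩ hv
    have hl : HasDerivAt (fun t : ℝ => Φ ((q₀, ε) + t • (k, e))) 0 0 := by
      have := hd.hasLineDerivAt (k, e)
      rwa [hv] at this
    have he : e = 0 := by
      have h1 : HasDerivAt (fun t : ℝ => ε + t * e) 0 0 := hl.snd
      have h2 : HasDerivAt (fun t : ℝ => ε + t * e) (1 * e) 0 :=
        ((hasDerivAt_id (0 : ℝ)).mul_const e).const_add ε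
      rw [one_mul] at h2
      exact h2.unique h1
    have hk : S.kktDeriv q₀ k = 0 := by
      have h1 : HasDerivAt (fun t : ℝ => S.kktMap P (q₀ + t • k) (ε + t • e)) 0 0 := hl.fst
      simp only [he, smul_zero, add_zero, kktMap_add_smul] at h1
      have h2 : HasDerivAt (fun t : ℝ => S.kktMap P q₀ ε + t • S.kktDeriv q₀ k +
          t ^ 2 • kktQuad k) (((1 : ℝ) • S.kktDeriv q₀ k) +
            ((2 : ℕ) * (0 : ℝ) ^ (2 - 1)) • kktQuad k) 0 :=
        (((hasDerivAt_id (0 : ℝ)).smul_const _).const_add _).add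
          ((hasDerivAt_pow 2 (0 : ℝ)).smul_const _)
      have h3 := h2.unique h1
      simpa using h3
    rw [he, h.eq_zero_of_kktDeriv hk]
    rfl
  have hinj : Function.Injective
      (fderiv ℝ Φ (q₀, ε) : KKTVar m d P × ℝ →ₗ[ℝ] KKTVar m d P × ℝ) :=
    fun a b hab => sub_eq_zero.1
      (hker _ ((map_sub (fderiv ℝ Φ (q₀, ε)) a b).trans (sub_eq_zero.2 hab)))
  -- In finite dimension an injective endomorphism is invertible.
  let D := (LinearEquiv.ofInjectiveEndo _ hinj).toContinuousLinearEquiv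
  have hD : HasFDerivAt Φ (D : KKTVar m d P × ℝ →L[ℝ] KKTVar m d P × ℝ) (q₀, ε) := by
    rwa [show (D : KKTVar m d P × ℝ →L[ℝ] KKTVar m d P × ℝ) = fderiv ℝ Φ (q₀, ε) from
      ContinuousLinearMap.ext fun v => rfl]
  have hst := hΦ.contDiffAt.hasStrictFDerivAt' hD (by simp)
  set g := hst.localInverse Φ D (q₀, ε) with hg
  have hΦ0 : Φ (q₀, ε) = (0, ε) := Prod.ext h.kktMap_kktPoint rfl
  have hga : AnalyticAt ℝ g (0, ε) := by
    have : ContDiffAt ℝ ⊤ g (Φ (q₀, ε)) := hΦ.contDiffAt.to_localInverse hD (by simp)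
    rw [hΦ0] at this
    exact this.analyticAt
  have hpair : AnalyticAt ℝ (fun e : ℝ => ((0 : KKTVar m d P), e)) ε :=
    analyticAt_const.prod analyticAt_id
  refine ⟨fun e => (g (0, e)).1, ?_, ?_, ?_, ?_⟩
  · exact analyticAt_fst.comp (hga.comp hpair)
  · have := hst.localInverse_apply_image
    rw [hΦ0] at this
    exact congrArg Prod.fst this
  · have h1 := hst.eventually_right_inverse
    rw [hΦ0] at h1
    filter_upwards [hpair.continuousAt.eventually h1] with e he
    have h2 : (g (0, e)).2 = e := congrArg Prod.snd he
    have h3 : S.kktMap P (g (0, e)).1 (g (0, e)).2 = 0 := congrArg Prod.fst he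
    rwa [h2] at h3
  · filter_upwards [hst.eventually_left_inverse] with z hz hz0
    have h1 : Φ z = (0, z.2) := Prod.ext hz0 rfl
    rw [h1] at hz
    exact (congrArg Prod.fst hz).symm

end IsNondegSol

variable {ε₀ ρ : ℝ}

theorem IsSolutionMap.mem_Ioo {χ : ℝ → KKTVar m d (S.partition ε₀)}
    (hχ : S.IsSolutionMap ε₀ ρ χ) : ε₀ ∈ Ioo (ε₀ - ρ) (ε₀ + ρ) := by
  constructor <;> linarith [hχ.1]

theorem IsSolutionMap.analyticAt {χ : ℝ → KKTVar m d (S.partition ε₀)}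
    (hχ : S.IsSolutionMap ε₀ ρ χ) : AnalyticAt ℝ χ ε₀ := hχ.2.1 ε₀ hχ.mem_Ioo

theorem IsSolutionMap.eventually_kktMap {χ : ℝ → KKTVar m d (S.partition ε₀)}
    (hχ : S.IsSolutionMap ε₀ ρ χ) : ∀ᶠ e in 𝓝 ε₀, S.kktMap (S.partition ε₀) (χ e) e = 0 := by
  filter_upwards [isOpen_Ioo.mem_nhds hχ.mem_Ioo] with e he using hχ.2.2.1 e he

variable {x s : BlockVec d} {y : Fin m → ℝ}

theorem IsSolutionMap.apply_self {χ : ℝ → KKTVar m d (S.partition ε₀)}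
    (hχ : S.IsSolutionMap ε₀ ρ χ) (h : S.IsNondegSol (S.partition ε₀) ε₀ x y s) :
    χ ε₀ = kktPoint _ x y s := h.eq_kktPoint (hχ.2.2.1 ε₀ hχ.mem_Ioo) hχ.2.2.2

/-- Solutions of the first-order system near the base point lie on the solution map. -/
theorem IsSolutionMap.eventually_eq {χ : ℝ → KKTVar m d (S.partition ε₀)}
    (hχ : S.IsSolutionMap ε₀ ρ χ) (h : S.IsNondegSol (S.partition ε₀) ε₀ x y s) :
    ∀ᶠ z in 𝓝 ((kktPoint (S.partition ε₀) x y s : KKTVar m d (S.partition ε₀)), ε₀),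
      S.kktMap (S.partition ε₀) z.1 z.2 = 0 → z.1 = χ z.2 := by
  obtain ⟨ξ, -, -, -, h4⟩ := h.exists_solution_branch
  have h5 : Tendsto (fun e => (χ e, e)) (𝓝 ε₀)
      (𝓝 ((kktPoint (S.partition ε₀) x y s : KKTVar m d (S.partition ε₀)), ε₀)) := by
    rw [← hχ.apply_self h]
    exact (hχ.analyticAt.continuousAt.prodMk continuousAt_id)
  -- Continuity keeps χ in the region where zeros of G lie on ξ, so the local uniqueness of ξ passes
  -- to χ.
  have h6 : ∀ᶠ e in 𝓝 ε₀, χ e = ξ e := by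
    filter_upwards [h5.eventually h4, hχ.eventually_kktMap] with e he he' using he he'
  filter_upwards [h4, continuousAt_snd.eventually h6] with z hz hz' hz0
  rw [hz hz0, hz']

/-- Local uniqueness gives agreement near ε₀, and the identity theorem extends it to the whole
interval. -/
theorem IsSolutionMap.eqOn {χ₁ χ₂ : ℝ → KKTVar m d (S.partition ε₀)}
    (h₁ : S.IsSolutionMap ε₀ ρ χ₁) (h₂ : S.IsSolutionMap ε₀ ρ χ₂)
    (h : S.IsNondegSol (S.partition ε₀) ε₀ x y s) : EqOn χ₁ χ₂ (Ioo (ε₀ - ρ) (ε₀ + ρ)) := by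
  refine h₁.2.1.eqOn_of_preconnected_of_eventuallyEq h₂.2.1 isPreconnected_Ioo h₁.mem_Ioo ?_
  have h5 : Tendsto (fun e => (χ₁ e, e)) (𝓝 ε₀)
      (𝓝 ((kktPoint (S.partition ε₀) x y s : KKTVar m d (S.partition ε₀)), ε₀)) := by
    rw [← h₁.apply_self h]
    exact (h₁.analyticAt.continuousAt.prodMk continuousAt_id)
  filter_upwards [h5.eventually (h₂.eventually_eq h), h₁.eventually_kktMap] with e he he'
    using he he'

theorem IsNondegSol.exists_isSolutionMap (h : S.IsNondegSol (S.partition ε₀) ε₀ x y s) :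
    ∃ ρ χ, S.IsSolutionMap ε₀ ρ χ := by
  obtain ⟨χ, h1, h2, h3, -⟩ := h.exists_solution_branch
  obtain ⟨ρ, hρ, hball⟩ := Metric.eventually_nhds_iff_ball.1 (h1.eventually_analyticAt.and h3)
  rw [Real.ball_eq_Ioo] at hball
  refine ⟨ρ, χ, hρ, fun e he => (hball e he).1, fun e he => (hball e he).2, ?_⟩
  rw [h2]
  exact h.isDNGlobalOpt_kktPoint

theorem IsNonlinearityInterval.partitionConstNear {J : Set ℝ} (hJ : S.IsNonlinearityInterval J)
    (h0 : ε₀ ∈ J) : S.PartitionConstNear ε₀ := by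
  obtain ⟨δ, hδ, hball⟩ := Metric.isOpen_iff.1 hJ.2.1 ε₀ h0
  rw [Real.ball_eq_Ioo] at hball
  exact ⟨δ, hδ, hball.trans hJ.2.2.2.1, fun e he => hJ.2.2.2.2.1 e (hball he) ε₀ h0⟩

/-- The maximal open interval of constancy of the optimal partition around a point. -/
theorem PartitionConstNear.exists_isNonlinearityInterval (h : S.PartitionConstNear ε₀)
    (hinv : ¬ ∃ J, S.IsInvariancyInterval J ∧ ε₀ ∈ J) :
    ∃ J, S.IsNonlinearityInterval J ∧ ε₀ ∈ J := by
  obtain ⟨δ, hδ, hdom, hconst⟩ := h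
  let F : Set (Set ℝ) := {J | IsOpen J ∧ J.OrdConnected ∧ J ⊆ interior S.dom ∧
    S.PartitionConstOn J ∧ ε₀ ∈ J}
  have hI : Ioo (ε₀ - δ) (ε₀ + δ) ∈ F :=
    ⟨isOpen_Ioo, ordConnected_Ioo, hdom, fun a ha b hb => (hconst a ha).trans (hconst b hb).symm,
      by constructor <;> linarith⟩
  have h0 : ε₀ ∈ ⋃₀ F := ⟨_, hI, hI.2.2.2.2⟩
  have h1 : IsOpen (⋃₀ F) := isOpen_sUnion fun J hJ => hJ.1
  -- All members contain ε₀, so their union is connected, and the partition on each member is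
  -- compared through ε₀.
  have h2 : (⋃₀ F).OrdConnected :=
    (isPreconnected_sUnion ε₀ F (fun J hJ => hJ.2.2.2.2)
      fun J hJ => hJ.2.1.isPreconnected).ordConnected
  have h3 : ⋃₀ F ⊆ interior S.dom := sUnion_subset fun J hJ => hJ.2.2.1
  have h4 : S.PartitionConstOn (⋃₀ F) := by
    rintro a ⟨J, hJ, ha⟩ b ⟨K, hK, hb⟩
    exact (hJ.2.2.2.1 a ha ε₀ hJ.2.2.2.2).trans (hK.2.2.2.1 b hb ε₀ hK.2.2.2.2).symm
  refine ⟨⋃₀ F, ⟨⟨ε₀, h0⟩, h1, h2, h3, h4, fun hr => hinv ⟨_, ⟨⟨ε₀, h0⟩, h1, h2, h3, h4, hr⟩, h0⟩,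
    fun J' a1 a2 a3 a4 a5 => ?_⟩, h0⟩
  exact (subset_sUnion_of_mem (show J' ∈ F from ⟨a1, a2, a3, a4, a5 h0⟩)).antisymm a5

end ParamSOCO

/-! ### Constancy of the partition and vanishing derivatives -/

theorem SocBdry.reflMat {k : ℕ} {a : Fin (k + 1) → ℝ} (h : SocBdry a) {c : ℝ} (hc : 0 < c) :
    SocBdry (c • (reflMat k *ᵥ a)) := by
  apply socBdry_of_dotProduct_reflMat_self
  · rw [Matrix.mulVec_smul, reflMat_mulVec_involutive, smul_dotProduct, dotProduct_smul,
      dotProduct_comm, h.dotProduct_reflMat_self, smul_zero, smul_zero]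
  · rw [Pi.smul_apply, reflMat_mulVec, reflSign_zero, one_mul]
    exact mul_pos hc h.pos

theorem ne_zero_of_tailNorm_lt {k : ℕ} {a : Fin (k + 1) → ℝ} (h : tailNorm a < a 0) : a ≠ 0 := by
  rintro rfl
  simp at h

namespace ParamSOCO

variable {m p : ℕ} {d : Fin p → ℕ} {S : ParamSOCO m p d} {P : ConePartition p}

theorem IsNondegSol.cover {ε : ℝ} {x s : BlockVec d} {y : Fin m → ℝ}
    (h : S.IsNondegSol P ε x y s) (i : Fin p) :
    i ∈ P.B ∨ i ∈ P.N ∨ i ∈ P.R ∨ i ∈ P.T1 ∨ i ∈ P.T2 ∨ i ∈ P.T3 := by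
  by_cases hi : i ∈ P.slackIdx
  · simp only [ConePartition.slackIdx, Finset.mem_union] at hi
    tauto
  · have := h.mem_of_notMem_slackIdx hi
    simp only [Finset.mem_union] at this
    tauto

/-- The positions of the blocks are determined by one direction of the defining equivalences. -/
theorem hasPattern_of_forall {x s : BlockVec d}
    (hcov : ∀ i, i ∈ P.B ∨ i ∈ P.N ∨ i ∈ P.R ∨ i ∈ P.T1 ∨ i ∈ P.T2 ∨ i ∈ P.T3)
    (hB : ∀ i ∈ P.B, tailNorm (x i) < x i 0 ∧ s i = 0)
    (hN : ∀ i ∈ P.N, x i = 0 ∧ tailNorm (s i) < s i 0)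
    (hR : ∀ i ∈ P.R, SocBdry (x i) ∧ SocBdry (s i))
    (hT1 : ∀ i ∈ P.T1, x i = 0 ∧ s i = 0)
    (hT2 : ∀ i ∈ P.T2, s i = 0 ∧ SocBdry (x i))
    (hT3 : ∀ i ∈ P.T3, x i = 0 ∧ SocBdry (s i)) : HasPattern P x s := by
  have key : ∀ {k : ℕ} (a : Fin (k + 1) → ℝ), (SocBdry a → ¬ tailNorm a < a 0) ∧
      (SocBdry a → ¬ a = 0) ∧ (tailNorm a < a 0 → ¬ a = 0) := fun a =>
    ⟨fun h => h.not_int, fun h => h.ne_zero, ne_zero_of_tailNorm_lt⟩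
  -- Interior, nonzero boundary and zero exclude one another, and the six classes prescribe six
  -- different pairs of positions; with the cover this gives the converse implications.
  constructor <;> intro i <;>
  · have c := hcov i
    have b1 := hB i
    have b2 := hN i
    have b3 := hR i
    have b4 := hT1 i
    have b5 := hT2 i
    have b6 := hT3 i
    have k1 := key (x i)
    have k2 := key (s i)
    clear hcov hB hN hR hT1 hT2 hT3 key
    grind

variable {ε₀ ρ : ℝ} {x s : BlockVec d} {y : Fin m → ℝ}

/-- A point of the first-order system with the sign pattern of a nondegenerate solution. -/
theorem IsNondegSol.of_kktMap (h : S.IsNondegSol P ε₀ x y s) {ε : ℝ} {q : KKTVar m d P}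
    (hq : S.kktMap P q ε = 0) (hB : ∀ i ∈ P.B, tailNorm ((-q.u) i) < (-q.u) i 0)
    (hN : ∀ i ∈ P.N, tailNorm (slackExt q.z i) < slackExt q.z i 0)
    (hquad : ∀ i ∈ P.quadIdx, 0 < slackExt q.z i 0) (hR : ∀ i ∈ P.R, 0 < multExt q.v i)
    (hT1 : ∀ i ∈ P.T1, q.u i = 0) (hT2 : ∀ i ∈ P.T2, SocBdry ((-q.u) i))
    (hT3 : ∀ i ∈ P.T3, multExt q.v i = 0) (hP : S.PrimalKer P (-q.u))
    (hD : S.DualKer P (slackExt q.z)) : S.IsNondegSol P ε (-q.u) q.w (slackExt q.z) := by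
  obtain ⟨k1, k2, k3, k4, k5⟩ := kktMap_eq_zero_iff.1 hq
  have hs0 : ∀ i ∈ P.B ∪ P.T1 ∪ P.T2, slackExt q.z i = 0 := fun i hi =>
    slackExt_of_notMem _ (h.notMem_slackIdx hi)
  have hbd : ∀ i ∈ P.quadIdx, SocBdry (slackExt q.z i) := fun i hi =>
    socBdry_of_dotProduct_reflMat_self (k5 i hi) (hquad i hi)
  have hx : ∀ i ∈ P.quadIdx,
      (-q.u) i = (2 * multExt q.v i) • (reflMat (d i) *ᵥ slackExt q.z i) := fun i hi => by
    rw [Pi.neg_apply, k2 i hi, neg_neg]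
  have hpat : HasPattern P (-q.u) (slackExt q.z) := by
    apply hasPattern_of_forall h.cover
    · exact fun i hi => ⟨hB i hi, hs0 i (by simp [hi])⟩
    · intro i hi
      have := h.mem_N_iff.1 hi
      exact ⟨by rw [Pi.neg_apply, k3 i this.1 this.2, neg_zero], hN i hi⟩
    · intro i hi
      have hi' : i ∈ P.quadIdx := Finset.mem_union_left _ hi
      refine ⟨?_, hbd i hi'⟩
      rw [hx i hi']
      exact (hbd i hi').reflMat (mul_pos two_pos (hR i hi))
    · exact fun i hi => ⟨by rw [Pi.neg_apply, hT1 i hi, neg_zero], hs0 i (by simp [hi])⟩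
    · exact fun i hi => ⟨hs0 i (by simp [hi]), hT2 i hi⟩
    · intro i hi
      have hi' : i ∈ P.quadIdx := Finset.mem_union_right _ hi
      exact ⟨by rw [hx i hi', hT3 i hi, mul_zero, zero_smul], hbd i hi'⟩
  have hsoc : ∀ i, (-q.u) i ∈ soc (d i) ∧ slackExt q.z i ∈ soc (d i) ∧
      (-q.u) i ⬝ᵥ slackExt q.z i = 0 := by
    intro i
    rcases h.cover i with hi | hi | hi | hi | hi | hi
    · rw [hs0 i (by simp [hi])]
      exact ⟨((hpat.B i).1 hi).le, zero_mem_soc, dotProduct_zero _⟩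
    · have := h.mem_N_iff.1 hi
      rw [Pi.neg_apply, k3 i this.1 this.2, neg_zero]
      exact ⟨zero_mem_soc, ((hpat.N i).1 hi).le, zero_dotProduct _⟩
    · have hi' := (hpat.R i).1 hi
      refine ⟨hi'.1.mem_soc, hi'.2.mem_soc, ?_⟩
      rw [hx i (Finset.mem_union_left _ hi), smul_dotProduct, dotProduct_comm,
        hi'.2.dotProduct_reflMat_self, smul_zero]
    · have hi' := (hpat.T1 i).1 hi
      rw [hi'.1, hi'.2]
      exact ⟨zero_mem_soc, zero_mem_soc, zero_dotProduct _⟩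
    · have hi' := (hpat.T2 i).1 hi
      rw [hi'.1]
      exact ⟨hi'.2.mem_soc, zero_mem_soc, dotProduct_zero _⟩
    · have hi' := (hpat.T3 i).1 hi
      rw [hi'.1]
      exact ⟨zero_mem_soc, hi'.2.mem_soc, zero_dotProduct _⟩
  exact ⟨⟨⟨k1, fun i => (hsoc i).1⟩, ⟨k4, fun i => (hsoc i).2.1⟩,
    Finset.sum_eq_zero fun i _ => (hsoc i).2.2⟩, hpat, hP, hD⟩

theorem continuous_slackExt :
    Continuous (slackExt : SlackVec d P → BlockVec d) := by
  refine continuous_pi fun i => ?_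
  unfold slackExt
  split_ifs <;> fun_prop

/-- The conditions for B, N, R, the sign of z^i_1 and both kernel conditions are open and persist by
continuity. Those for T1, T2 and T3 contain equations; vanishing derivatives freeze these at their
values at ε₀, which are zero. -/
theorem IsSolutionMap.partitionConstNear {χ : ℝ → KKTVar m d (S.partition ε₀)}
    (hχ : S.IsSolutionMap ε₀ ρ χ) (h : S.IsNondegSol (S.partition ε₀) ε₀ x y s)
    (hder : S.DerivativesVanish ε₀ χ) : S.PartitionConstNear ε₀ := by
  obtain ⟨d1, d2, d3⟩ := hder
  have h0 := hχ.apply_self h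
  have ha := hχ.analyticAt
  have hau : AnalyticAt ℝ (fun e => (χ e).u) ε₀ :=
    analyticAt_fst.comp (analyticAt_snd.comp (analyticAt_snd.comp ha))
  have hav : AnalyticAt ℝ (fun e => (χ e).v) ε₀ :=
    analyticAt_snd.comp (analyticAt_snd.comp (analyticAt_snd.comp ha))
  have haz : AnalyticAt ℝ (fun e => (χ e).z) ε₀ := analyticAt_fst.comp (analyticAt_snd.comp ha)
  have hui : ∀ i j, AnalyticAt ℝ (fun e => (χ e).u i j) ε₀ := fun i j =>
    analyticAt_pi_iff.1 (analyticAt_pi_iff.1 hau i) j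
  have hu0 : -(χ ε₀).u = x := by rw [h0]; exact neg_neg x
  have hz0 : slackExt (χ ε₀).z = s := by
    rw [h0]; exact slackExt_restrict fun _ hi => h.slack_eq_zero_of_notMem hi
  have tx : Tendsto (fun e => -(χ e).u) (𝓝 ε₀) (𝓝 x) := by
    rw [← hu0]; exact hau.continuousAt.neg
  have ts : Tendsto (fun e => slackExt (χ e).z) (𝓝 ε₀) (𝓝 s) := by
    rw [← hz0]; exact continuous_slackExt.continuousAt.comp haz.continuousAt
  have txi := fun i => tendsto_pi_nhds.1 tx i
  have tsi := fun i => tendsto_pi_nhds.1 ts i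
  have eB : ∀ᶠ e in 𝓝 ε₀, ∀ i ∈ (S.partition ε₀).B,
      tailNorm ((-(χ e).u) i) < (-(χ e).u) i 0 := by
    refine (Finset.eventually_all _).2 fun i hi => ?_
    exact (txi i).eventually (isOpen_socInt.mem_nhds ((h.pattern.B i).1 hi))
  have eN : ∀ᶠ e in 𝓝 ε₀, ∀ i ∈ (S.partition ε₀).N,
      tailNorm (slackExt (χ e).z i) < slackExt (χ e).z i 0 := by
    refine (Finset.eventually_all _).2 fun i hi => ?_
    exact (tsi i).eventually (isOpen_socInt.mem_nhds ((h.pattern.N i).1 hi))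
  have eQ : ∀ᶠ e in 𝓝 ε₀, ∀ i ∈ (S.partition ε₀).quadIdx, 0 < slackExt (χ e).z i 0 := by
    refine (Finset.eventually_all _).2 fun i hi => ?_
    exact (tendsto_pi_nhds.1 (tsi i) 0).eventually_const_lt (h.socBdry_of_mem_quadIdx hi).pos
  have eR : ∀ᶠ e in 𝓝 ε₀, ∀ i ∈ (S.partition ε₀).R, 0 < multExt (χ e).v i := by
    refine (Finset.eventually_all _).2 fun i hi => ?_
    have hi' : i ∈ (S.partition ε₀).quadIdx := Finset.mem_union_left _ hi
    simp only [multExt_of_mem _ hi']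
    refine (analyticAt_pi_iff.1 hav ⟨i, hi'⟩).continuousAt.eventually_const_lt ?_
    beta_reduce
    rw [h0]
    obtain ⟨hx, hs⟩ := (h.pattern.R i).1 hi
    exact div_pos hx.pos (mul_pos two_pos hs.pos)
  have eT1 : ∀ᶠ e in 𝓝 ε₀, ∀ i ∈ (S.partition ε₀).T1, (χ e).u i = 0 := by
    refine (Finset.eventually_all _).2 fun i hi => ?_
    have := fun j => (hui i j).eventually_eq_of_iteratedDeriv (d1 i hi j)
    filter_upwards [eventually_all.2 this] with e he
    funext j
    rw [he j, h0]
    change -(x i j) = 0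
    rw [((h.pattern.T1 i).1 hi).1, Pi.zero_apply, neg_zero]
  have eT2 : ∀ᶠ e in 𝓝 ε₀, ∀ i ∈ (S.partition ε₀).T2, SocBdry ((-(χ e).u) i) := by
    refine (Finset.eventually_all _).2 fun i hi => ?_
    have hbd := ((h.pattern.T2 i).1 hi).2
    have han : AnalyticAt ℝ (fun e => (χ e).u i 0 ^ 2 - tailNorm ((χ e).u i) ^ 2) ε₀ := by
      simp only [tailNorm_sq]
      exact ((hui i 0).pow 2).sub
        (Finset.analyticAt_fun_sum _ fun j _ => (hui i j.succ).pow 2)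
    have hpos := (tendsto_pi_nhds.1 (txi i) 0).eventually_const_lt hbd.pos
    filter_upwards [han.eventually_eq_of_iteratedDeriv (d2 i hi), hpos] with e he hp
    refine socBdry_of_dotProduct_reflMat_self ?_ hp
    have h1 : ∀ a : Fin (d i + 1) → ℝ,
        (-a) ⬝ᵥ (reflMat (d i) *ᵥ (-a)) = a ⬝ᵥ (reflMat (d i) *ᵥ a) := fun a => by
      rw [Matrix.mulVec_neg, neg_dotProduct_neg]
    rw [Pi.neg_apply, h1, dotProduct_reflMat_self, he, ← dotProduct_reflMat_self, ← h1]
    change (-(χ ε₀).u) i ⬝ᵥ (reflMat (d i) *ᵥ (-(χ ε₀).u) i) = 0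
    rw [hu0, hbd.dotProduct_reflMat_self]
  have eT3 : ∀ᶠ e in 𝓝 ε₀, ∀ i ∈ (S.partition ε₀).T3, multExt (χ e).v i = 0 := by
    refine (Finset.eventually_all _).2 fun i hi => ?_
    have hi' := ConePartition.mem_quadIdx_of_mem_T3 hi
    simp only [multExt_of_mem _ hi']
    filter_upwards [(analyticAt_pi_iff.1 hav ⟨i, hi'⟩).eventually_eq_of_iteratedDeriv
      (d3 i hi)] with e he
    rw [he, h0]
    change x i 0 / _ = 0
    rw [((h.pattern.T3 i).1 hi).1, Pi.zero_apply, zero_div]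
  have main : ∀ᶠ e in 𝓝 ε₀, e ∈ S.dom ∧ S.partition e = S.partition ε₀ := by
    filter_upwards [hχ.eventually_kktMap, eB, eN, eQ, eR, eT1, eT2, eT3,
      tx.eventually h.primalKer.eventually, ts.eventually h.dualKer.eventually]
      with e h1 h2 h3 h4 h5 h6 h7 h8 h9 h10
    have := h.of_kktMap h1 h2 h3 h4 h5 h6 h7 h8 h9 h10
    exact ⟨this.isSol.mem_dom, this.partition_eq⟩
  obtain ⟨δ, hδ, hball⟩ := Metric.eventually_nhds_iff_ball.1 main
  rw [Real.ball_eq_Ioo] at hball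
  exact ⟨δ, hδ, interior_maximal (fun e he => (hball e he).1) isOpen_Ioo,
    fun e he => (hball e he).2⟩

/-- Optimal solutions exist as long as the optimal partition is that of a nondegenerate solution. -/
theorem IsNondegSol.exists_isSol (hIPC : S.InteriorPointCondition)
    (h : S.IsNondegSol P ε₀ x y s) {ε : ℝ} (hP : S.partition ε = P) (i : Fin p) :
    ∃ x' y' s', S.IsSol ε x' y' s' := by
  classical
  by_contra hno
  -- Without an optimal pair the condition defining T1 holds vacuously for every index.
  have hT1 : ∀ j, j ∈ P.T1 := by
    intro j
    rw [← hP]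
    refine Finset.mem_filter.2 ⟨Finset.mem_univ _, fun x' hx' q hq => ?_⟩
    exact absurd ⟨x', q.1, q.2, isSol_of_mem_opt hx' hq⟩ hno
  have hx0 : ∀ j, x j = 0 := fun j => ((h.pattern.T1 j).1 (hT1 j)).1
  have hs0 : ∀ j, s j = 0 := fun j => ((h.pattern.T1 j).1 (hT1 j)).2
  obtain ⟨⟨z, hz, hzint⟩, -⟩ := hIPC
  have hb : S.b = 0 := by
    rw [← h.isSol.1.1]
    exact Finset.sum_eq_zero fun j _ => by rw [hx0 j, Matrix.mulVec_zero]
  -- Now x, s and b are zero, and N, R and T3 are empty, so `DualKer` makes A injective. The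
  -- strictly feasible point would then be zero, which a cone with index i contradicts.
  have hz0 : z = 0 := by
    apply h.dualKer z (hz.1.trans hb)
    · intro j hj
      exact absurd (hs0 j) (ne_zero_of_tailNorm_lt ((h.pattern.N j).1 hj))
    · intro j hj
      exact absurd (hs0 j) (h.socBdry_of_mem_quadIdx hj).ne_zero
  exact ne_zero_of_tailNorm_lt (hzint i) (congrFun hz0 i)

theorem continuousAt_kktPoint
    (hs : ∀ i ∈ P.quadIdx, SocBdry (s i)) :
    ContinuousAt (fun q : BlockVec d × (Fin m → ℝ) × BlockVec d =>
      (kktPoint P q.1 q.2.1 q.2.2 : KKTVar m d P)) (x, y, s) := by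
  have hx : ∀ i, Continuous fun q : BlockVec d × (Fin m → ℝ) × BlockVec d => q.1 i :=
    fun i => by fun_prop
  have hs' : ∀ i, Continuous fun q : BlockVec d × (Fin m → ℝ) × BlockVec d => q.2.2 i :=
    fun i => by fun_prop
  refine ContinuousAt.prodMk (by fun_prop) (ContinuousAt.prodMk ?_ (ContinuousAt.prodMk ?_ ?_))
  · exact continuousAt_pi.2 fun i => (hs' i).continuousAt
  · exact (by fun_prop : Continuous fun q : BlockVec d × (Fin m → ℝ) × BlockVec d =>
      -q.1).continuousAt
  · refine continuousAt_pi.2 fun i => ContinuousAt.div ?_ ?_ ?_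
    · exact (continuous_pi_iff.1 (hx i) 0).continuousAt
    · exact (continuous_const.mul (continuous_pi_iff.1 (hs' i) 0)).continuousAt
    · exact (mul_pos two_pos (hs i.1 i.2).pos).ne'

/-- While the optimal partition is constant, the solution map consists of optimal solutions. -/
theorem IsSolutionMap.eventually_exists_isSol (hIPC : S.InteriorPointCondition)
    {χ : ℝ → KKTVar m d (S.partition ε₀)} (hχ : S.IsSolutionMap ε₀ ρ χ)
    (h : S.IsNondegSol (S.partition ε₀) ε₀ x y s) (hconst : S.PartitionConstNear ε₀)
    (i₀ : Fin p) :
    ∀ᶠ e in 𝓝 ε₀, S.partition e = S.partition ε₀ ∧ ∃ x' y' s', S.IsSol e x' y' s' ∧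
      (∀ i ∈ (S.partition ε₀).T2, SocBdry (x' i)) ∧
      χ e = kktPoint (S.partition ε₀) x' y' s' := by
  classical
  have hc := continuousAt_kktPoint (x := x) (y := y) (P := S.partition ε₀)
    (fun i hi => h.socBdry_of_mem_quadIdx hi)
  have hpull : ∀ᶠ z in 𝓝 (x, y, s) ×ˢ 𝓝 ε₀, S.kktMap (S.partition ε₀)
      (kktPoint (S.partition ε₀) z.1.1 z.1.2.1 z.1.2.2) z.2 = 0 →
      kktPoint (S.partition ε₀) z.1.1 z.1.2.1 z.1.2.2 = χ z.2 := by
    have := hχ.eventually_eq h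
    rw [nhds_prod_eq] at this
    exact ((hc.tendsto.comp tendsto_fst).prodMk tendsto_snd).eventually this
  -- The neighbourhood is split into a condition on the solution and one on the parameter, since the
  -- solutions are only known once the parameter is fixed.
  obtain ⟨pa, hpa, pb, hpb, hab⟩ := eventually_prod_iff.1 hpull
  have hx0 : ∀ᶠ q : BlockVec d × (Fin m → ℝ) × BlockVec d in 𝓝 (x, y, s),
      ∀ i ∈ (S.partition ε₀).T2, q.1 i ≠ 0 := by
    refine (Finset.eventually_all _).2 fun i hi => ?_
    have hcx : Continuous fun q : BlockVec d × (Fin m → ℝ) × BlockVec d => q.1 i := by fun_prop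
    exact hcx.continuousAt.eventually_ne ((h.pattern.T2 i).1 hi).2.ne_zero
  have hs0 : ∀ᶠ q : BlockVec d × (Fin m → ℝ) × BlockVec d in 𝓝 (x, y, s),
      ∀ i ∈ (S.partition ε₀).quadIdx, q.2.2 i ≠ 0 := by
    refine (Finset.eventually_all _).2 fun i hi => ?_
    have hcs : Continuous fun q : BlockVec d × (Fin m → ℝ) × BlockVec d => q.2.2 i := by fun_prop
    exact hcs.continuousAt.eventually_ne (h.socBdry_of_mem_quadIdx hi).ne_zero
  obtain ⟨δ, hδ, -, hδ'⟩ := hconst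
  have hI : Ioo (ε₀ - δ) (ε₀ + δ) ∈ 𝓝 ε₀ := Ioo_mem_nhds (by linarith) (by linarith)
  filter_upwards [hI, hpb, h.isSol.eventually_mem (fun _ _ _ h' => h.eq_of_isSol h')
    (hpa.and (hx0.and hs0))] with e he hpe hnear
  have hpart := hδ' e he
  obtain ⟨x', y', s', hsol⟩ := h.exists_isSol hIPC hpart i₀
  obtain ⟨n1, n2, n3⟩ := hnear x' y' s' hsol
  have hxo := hsol.mem_primalOpt
  have hqo := hsol.mem_dualOpt
  refine ⟨hpart, x', y', s', hsol, fun i hi => ?_, ?_⟩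
  -- Nearness to x^i rules out zero. An interior block would put i into B at e, hence into B at ε₀,
  -- where x^i is a boundary point.
  · refine ((soc_trichotomy (hsol.1.2 i)).resolve_left fun hint => ?_).resolve_right (n2 i hi)
    have hB : i ∈ (S.partition e).B := Finset.mem_filter.2 ⟨Finset.mem_univ _, x', hxo, hint⟩
    rw [hpart, h.pattern.B] at hB
    exact ((h.pattern.T2 i).1 hi).2.not_int hB
  · refine (hab n1 hpe (hsol.kktMap_kktPoint (fun i hi => ?_) (fun i hi hi' => ?_)
      (fun i hi => ?_))).symm
    · have hi' := h.mem_of_notMem_slackIdx hi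
      rw [← hpart] at hi'
      simp only [Finset.mem_union] at hi'
      rcases hi' with (hi' | hi') | hi'
      · obtain ⟨z, hz, hint⟩ := (Finset.mem_filter.1 hi').2
        exact eq_zero_of_socInt_dotProduct hint (hsol.2.1.2 i) (complementary_of_mem_opt hz hqo i)
      · exact ((Finset.mem_filter.1 hi').2 x' hxo _ hqo).2
      · exact (Finset.mem_filter.1 hi').2.1 _ hqo
    · have hN := h.mem_N_iff.2 ⟨hi, hi'⟩
      rw [← hpart] at hN
      obtain ⟨q, hq, hint⟩ := (Finset.mem_filter.1 hN).2
      refine eq_zero_of_socInt_dotProduct hint (hsol.1.2 i) ?_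
      rw [dotProduct_comm]
      exact complementary_of_mem_opt hxo hq i
    · refine ((soc_trichotomy (hsol.2.1.2 i)).resolve_left fun hint => ?_).resolve_right (n3 i hi)
      have hN : i ∈ (S.partition e).N :=
        Finset.mem_filter.2 ⟨Finset.mem_univ _, (y', s'), hqo, hint⟩
      rw [hpart] at hN
      exact (h.mem_N_iff.1 hN).2 hi

/-- Near ε₀ the map χ is made of optimal solutions with the same partition, so each function in (∗)
is identically zero there. -/
theorem IsSolutionMap.derivativesVanish (hIPC : S.InteriorPointCondition)
    {χ : ℝ → KKTVar m d (S.partition ε₀)} (hχ : S.IsSolutionMap ε₀ ρ χ)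
    (h : S.IsNondegSol (S.partition ε₀) ε₀ x y s) (hconst : S.PartitionConstNear ε₀) :
    S.DerivativesVanish ε₀ χ := by
  classical
  -- The existence of solutions needs at least one cone; in each case below the index under
  -- consideration provides it.
  have key := hχ.eventually_exists_isSol hIPC h hconst
  refine ⟨fun i hi j k _ => iteratedDeriv_eq_zero_of_eventually ?_ k,
    fun i hi k _ => iteratedDeriv_eq_zero_of_eventually ?_ k,
    fun i hi k _ => iteratedDeriv_eq_zero_of_eventually ?_ k⟩
  · filter_upwards [key i] with e he
    obtain ⟨hp, x', y', s', hsol, -, he⟩ := he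
    rw [← hp] at hi
    have h1 := ((Finset.mem_filter.1 hi).2 x' hsol.mem_primalOpt _ hsol.mem_dualOpt).1
    rw [he]
    change -(x' i j) = 0
    rw [h1, Pi.zero_apply, neg_zero]
  · filter_upwards [key i] with e he
    obtain ⟨-, x', y', s', hsol, hbd, he⟩ := he
    rw [he, ← dotProduct_reflMat_self]
    change (-(x' i)) ⬝ᵥ (reflMat (d i) *ᵥ (-(x' i))) = 0
    rw [Matrix.mulVec_neg, neg_dotProduct_neg, (hbd i hi).dotProduct_reflMat_self]
  · filter_upwards [key i] with e he
    obtain ⟨hp, x', y', s', hsol, -, he⟩ := he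
    rw [he]
    rw [← hp] at hi
    have h1 := (Finset.mem_filter.1 hi).2.1 x' hsol.mem_primalOpt
    change x' i 0 / _ = 0
    rw [h1, Pi.zero_apply, zero_div]

end ParamSOCO

/-! ### The main theorem -/

theorem mainTheorem1 {m p : ℕ} {d : Fin p → ℕ} (S : ParamSOCO m p d)
    (hIPC : S.InteriorPointCondition) (ε₀ : ℝ) (hnd : S.NondegenerateAt ε₀) :
    (∃! x, x ∈ S.primalOpt ε₀) ∧ (∃! q, q ∈ S.dualOpt ε₀) ∧
    (∃ ρ χ, S.IsSolutionMap ε₀ ρ χ) ∧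
    (∀ ρ χ₁ χ₂, S.IsSolutionMap ε₀ ρ χ₁ → S.IsSolutionMap ε₀ ρ χ₂ →
      Set.EqOn χ₁ χ₂ (Set.Ioo (ε₀ - ρ) (ε₀ + ρ))) ∧
    ∀ ρ χ, S.IsSolutionMap ε₀ ρ χ →
      (S.PartitionConstNear ε₀ ↔ S.DerivativesVanish ε₀ χ) ∧
      ((¬ ∃ J, S.IsInvariancyInterval J ∧ ε₀ ∈ J) →
        ((∃ J, S.IsNonlinearityInterval J ∧ ε₀ ∈ J) ↔ S.DerivativesVanish ε₀ χ)) := by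
  obtain ⟨x, y, s, h⟩ := hnd.exists_isNondegSol
  refine ⟨⟨x, h.isSol.mem_primalOpt, h.primal_unique⟩,
    ⟨(y, s), h.isSol.mem_dualOpt, h.dual_unique⟩, h.exists_isSolutionMap,
    fun ρ χ₁ χ₂ h₁ h₂ => h₁.eqOn h₂ h, fun ρ χ hχ => ?_⟩
  have hiff : S.PartitionConstNear ε₀ ↔ S.DerivativesVanish ε₀ χ :=
    ⟨hχ.derivativesVanish hIPC h, hχ.partitionConstNear h⟩
  refine ⟨hiff, fun hinv => ⟨?_, fun hder => (hiff.2 hder).exists_isNonlinearityInterval hinv⟩⟩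
  rintro ⟨J, hJ, h0⟩
  exact hiff.1 (hJ.partitionConstNear h0)
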